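/- **Setting.** Let $\Pi_n$ be the set of $n\times n$ permutation matrices, $\|\cdot\|_F$ the Frobenius norm, and $\circ$ the entrywise (Hadamard) product. For $\beta\in[0,1]$ and an integer $d\ge 0$, the Newman–Watts graph $\mathrm{NW}(n,d,\beta)$ is the random graph on $\{1,\dots,n\}$ in which any two distinct vertices $i,j$ at ring distance $\min(|i-j|,\,n-|i-j|)\le d$ are joined, and every other pair of vertices is joined independently with probability $\beta$. Let $n_0>0$ and, for $n\ge n_0$, let $d_n\ge 0$ be integers, $\beta_n\in[0,1]$, $0\le p_n<1/2$ and $P_n\in\Pi_n$. Let $(A_n)_{n\ge n_0}$ be independent (adjacency matrices of) random graphs with $A_n\sim \mathrm{NW}(n,d_n,\beta_n)$. Let $(X_n)_{n\ge n_0}$ be independent random symmetric matrices with zero diagonal, where the entries of $X_n$ above the diagonal are i.i.d. Bernoulli$(p_n)$ and $X_n$ is independent of $A_n$. Let $$B_n=P_n\big(X_n\circ(\mathbf 1-A_n)+(\mathbf 1-X_n)\circ A_n\big)P_n^T ,$$ with $\mathbf 1$ the all-ones matrix, be the channel-corrupted graphs. The maximum likelihood estimators (MLEs) of $P_n$ are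 the elements of $$\mathcal P_n^*=\operatorname*{arg\,min}_{P\in\Pi_n}\|A_n-P^TB_nP\|_F^2 .$$ The MLE of $(P_n)_{n\ge n_0}$ is called weakly (strongly) consistent if $\max_{Q\in\mathcal P_n^*}\|Q-P_n\|_F\to 0$ in probability (almost surely) as $n\to\infty$. **Statement.** (a) For any sequence $(d_n)$: if $(1/2-p_n)^2=o\big(\sqrt{\log n/n}\big)$ and $\beta_n=o\Big(\dfrac{\log n}{(1/2-p_n)^2\,n}\Big)$, then the MLE of $(P_n)_{n\ge n_0}$ is not weakly consistent. (b) If $d_n=o(\beta_n^2 n)$, $\beta_n\le 1/2$ for all $n\ge n_0$, and $\beta_n=\omega\Big(\sqrt{\dfrac{\log n}{(1/2-p_n)^2\,n}}\Big)$, then the MLE of $(P_n)_{n\ge n_0}$ is strongly consistent. -/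

import Mathlib

open MeasureTheory ProbabilityTheory Filter Topology Asymptotics
open scoped unitInterval Matrix

/- On matrices, `‖·‖` is the Frobenius norm. -/
attribute [local instance] Matrix.frobeniusNormedAddCommGroup

/-- Square matrices carry the product sigma-algebra of their entries. -/
instance instMeasurableSpaceRealMatrix (n : ℕ) :
    MeasurableSpace (Matrix (Fin n) (Fin n) ℝ) :=
  inferInstanceAs (MeasurableSpace (Fin n → Fin n → ℝ))

/-- `M ∼ Bernoulli(Λ)`: the random matrix `M` is symmetric and hollow, and its entries above the
diagonal are independent, the `(i, j)` entry being `1` with probability `Λ i j` and `0` with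
probability `1 - Λ i j`. -/
structure IsBernoulliGraph {Ω : Type*} [MeasurableSpace Ω] (μ : Measure Ω) {n : ℕ}
    (Λ : Fin n → Fin n → I) (M : Ω → Matrix (Fin n) (Fin n) ℝ) : Prop where
  symm : ∀ ω i j, M ω i j = M ω j i
  hollow : ∀ ω i, M ω i i = 0
  law : ∀ i j, i < j → HasLaw (fun ω => M ω i j) (bernoulliMeasure (1 : ℝ) 0 (Λ i j)) μ
  indep : iIndepFun (fun (e : {e : Fin n × Fin n // e.1 < e.2}) ω => M ω e.1.1 e.1.2) μ

/-- Distance of two vertices along the ring (cycle) on `n` vertices. -/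
def ringDist {n : ℕ} (i j : Fin n) : ℕ :=
  min ((i : ℤ) - (j : ℤ)).natAbs (n - ((i : ℤ) - (j : ℤ)).natAbs)

/-- `A ∼ NW(n, d, β)`: all pairs of distinct vertices at ring distance at most `d` are joined
(the `d`-ring lattice), and every other pair is joined independently with probability `β`. -/
def IsNewmanWatts {Ω : Type*} [MeasurableSpace Ω] (μ : Measure Ω) (n d : ℕ) (β : I)
    (A : Ω → Matrix (Fin n) (Fin n) ℝ) : Prop :=
  IsBernoulliGraph μ (fun i j => if ringDist i j ≤ d then 1 else β) A

/-- The noise of the uniform corrupting channel: a symmetric hollow matrix with i.i.d.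
`Bernoulli(p)` entries above the diagonal. -/
def IsChannelNoise {Ω : Type*} [MeasurableSpace Ω] (μ : Measure Ω) (n : ℕ) (p : I)
    (X : Ω → Matrix (Fin n) (Fin n) ℝ) : Prop :=
  IsBernoulliGraph μ (fun _ _ => p) X

/-- The set `Π_n` of `n × n` permutation matrices. -/
def permMatrices (n : ℕ) : Set (Matrix (Fin n) (Fin n) ℝ) :=
  Set.range fun s : Equiv.Perm (Fin n) => s.permMatrix ℝ

/-- The channel-corrupted graph `P (X ∘ (1 - A) + (1 - X) ∘ A) Pᵀ`, where `∘` is the Hadamard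
product and `1` is the all-ones matrix. -/
def corrupt {n : ℕ} (A X P : Matrix (Fin n) (Fin n) ℝ) : Matrix (Fin n) (Fin n) ℝ :=
  P * (Matrix.hadamard X (Matrix.of (fun _ _ => 1) - A)
    + Matrix.hadamard (Matrix.of (fun _ _ => 1) - X) A) * Pᵀ

/-- The set of MLEs (for `p < 1/2`), i.e. of solutions of the graph matching problem:
the minimizers over `P ∈ Π_n` of `‖A - Pᵀ B P‖_F²`. -/
def mleSet {n : ℕ} (A B : Matrix (Fin n) (Fin n) ℝ) : Set (Matrix (Fin n) (Fin n) ℝ) :=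
  {P | P ∈ permMatrices n ∧ ∀ Q ∈ permMatrices n, ‖A - Pᵀ * B * P‖ ^ 2 ≤ ‖A - Qᵀ * B * Q‖ ^ 2}

/-- `max ‖Q - P‖_F` over the MLEs `Q`. -/
noncomputable def mleError {n : ℕ} (A B P : Matrix (Fin n) (Fin n) ℝ) : ℝ :=
  sSup ((fun Q => ‖Q - P‖) '' mleSet A B)

/-- The supremum in `mleError` is a maximum. -/
theorem mleError_isGreatest {n : ℕ} (A B P : Matrix (Fin n) (Fin n) ℝ) :
    IsGreatest ((fun Q => ‖Q - P‖) '' mleSet A B) (mleError A B P) := by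
  have hfin : (permMatrices n).Finite := Set.finite_range _
  have hne : (permMatrices n).Nonempty := Set.range_nonempty _
  obtain ⟨P0, hP0, hmin⟩ :=
    Set.exists_min_image (permMatrices n) (fun Q => ‖A - Qᵀ * B * Q‖ ^ 2) hfin hne
  have h1 : ((fun Q => ‖Q - P‖) '' mleSet A B).Finite :=
    (hfin.subset fun Q hQ => hQ.1).image _
  have h2 : ((fun Q => ‖Q - P‖) '' mleSet A B).Nonempty :=
    ⟨_, P0, ⟨hP0, hmin⟩, rfl⟩
  exact ⟨h2.csSup_mem h1, fun _ hx => le_csSup h1.bddAbove hx⟩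

/-- The MLE of `(P_n)` is weakly consistent: the largest error of an MLE tends to `0` in
probability. -/
def MLEWeaklyConsistent {Ω : Type*} [MeasurableSpace Ω] (μ : Measure Ω)
    (A B : (n : ℕ) → Ω → Matrix (Fin n) (Fin n) ℝ) (P : (n : ℕ) → Matrix (Fin n) (Fin n) ℝ) :
    Prop :=
  TendstoInMeasure μ (fun n ω => mleError (A n ω) (B n ω) (P n)) atTop (fun _ => 0)

/-- The MLE of `(P_n)` is strongly consistent: the largest error of an MLE tends to `0` almost
surely. -/
def MLEStronglyConsistent {Ω : Type*} [MeasurableSpace Ω] (μ : Measure Ω)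
    (A B : (n : ℕ) → Ω → Matrix (Fin n) (Fin n) ℝ) (P : (n : ℕ) → Matrix (Fin n) (Fin n) ℝ) :
    Prop :=
  ∀ᵐ ω ∂μ, Tendsto (fun n => mleError (A n ω) (B n ω) (P n)) atTop (𝓝 0)

/-! Write `δ = 1/2 - p` and measure every candidate relative to the true permutation. For a
permutation `s`, only the vertex pairs on which `a` and its image under `s` differ affect the cost.
On such a pair, `s` loses one unit if the noise leaves the pair alone and gains one if the noise
flips it (`matchCost_sub`). So `s` ties with or beats the truth exactly when at least half of its
disagreement pairs are flipped. Distinct permutation matrices are at distance at least 1, so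
consistency is about whether some `s ≠ 1` does this.

Consistency. Given the graph, a Chernoff bound gives probability at most `(1 - δ²)^|disagree|`. A
permutation moving `k` vertices admits at least `kn/24` non-lattice pairs whose images avoid this
set (`exists_displaced_pairs`). Resampling them one at a time shows that each disagrees with
conditional probability at least `β`, so the average is at most `exp(-δ²βn/24)^k`
(`bernMean_matchCost_le`). A union bound over permutations gives `2/n²`, and Borel–Cantelli
concludes.

Inconsistency. Use the `n/2` disjoint transpositions of consecutive vertices. Each has an even
number of disagreements, with mean at most `32 + 8βn` whatever `d` is. An exact tie, with half of
the disagreements flipped, has probability of order at least `exp(-4δ²|disagree|)/√n`. Two such ties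
share at most 8 noise variables, so a second moment argument (`bernMean_exists_ge`) yields some tie
with probability bounded below. A tie already produces a wrong minimizer.

All estimates are made for finite weighted sums over Boolean configurations and then transferred to
`μ`. -/

/-! ### Finite products of Bernoulli laws -/

section BernoulliMean

variable {ι : Type*} [Fintype ι]

/-- The mass of `b` under the Bernoulli law with parameter `q`. -/
def bernMass (q : ℝ) (b : Bool) : ℝ := if b then q else 1 - q

/-- The mass of `a` under the product of Bernoulli laws with parameters `q i`. -/
def bernWeight (q : ι → ℝ) (a : ι → Bool) : ℝ := ∏ i, bernMass (q i) (a i)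

theorem bernMass_nonneg {q : ℝ} (h0 : 0 ≤ q) (h1 : q ≤ 1) (b : Bool) : 0 ≤ bernMass q b := by
  unfold bernMass; split_ifs <;> linarith

theorem bernWeight_nonneg {q : ι → ℝ} (h0 : ∀ i, 0 ≤ q i) (h1 : ∀ i, q i ≤ 1) (a : ι → Bool) :
    0 ≤ bernWeight q a :=
  Finset.prod_nonneg fun i _ => bernMass_nonneg (h0 i) (h1 i) _

variable [DecidableEq ι]

/-- The expectation of `f` under the product of Bernoulli laws with parameters `q i`. -/
def bernMean (q : ι → ℝ) (f : (ι → Bool) → ℝ) : ℝ := ∑ a, bernWeight q a * f a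

theorem bernMean_prod (q : ι → ℝ) (f : ι → Bool → ℝ) :
    bernMean q (fun a => ∏ i, f i (a i)) = ∏ i, (q i * f i true + (1 - q i) * f i false) := by
  have h := Finset.prod_univ_sum (fun _ : ι => (Finset.univ : Finset Bool))
    (fun i b => bernMass (q i) b * f i b)
  rw [Fintype.piFinset_univ] at h
  simp only [bernMean, bernWeight, ← Finset.prod_mul_distrib]
  rw [← h]
  refine Finset.prod_congr rfl fun i _ => ?_
  simp [bernMass]

theorem bernMean_prod_finset (q : ι → ℝ) (S : Finset ι) (f : ι → Bool → ℝ) :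
    bernMean q (fun a => ∏ i ∈ S, f i (a i)) =
      ∏ i ∈ S, (q i * f i true + (1 - q i) * f i false) := by
  have h := bernMean_prod q (fun i b => if i ∈ S then f i b else 1)
  have e : ∀ i, q i * (if i ∈ S then f i true else 1) + (1 - q i) * (if i ∈ S then f i false else 1)
      = if i ∈ S then q i * f i true + (1 - q i) * f i false else 1 := by
    intro i; split_ifs <;> ring
  simp only [e] at h
  simpa [Finset.prod_ite_mem] using h

theorem bernMean_const (q : ι → ℝ) (c : ℝ) : bernMean q (fun _ => c) = c := by
  have h := bernMean_prod_finset q ∅ (fun _ _ => 1)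
  simp only [Finset.prod_empty, bernMean, mul_one] at h
  rw [bernMean, ← Finset.sum_mul, h, one_mul]

theorem bernMean_apply (q : ι → ℝ) (i : ι) (g : Bool → ℝ) :
    bernMean q (fun a => g (a i)) = q i * g true + (1 - q i) * g false := by
  simpa using bernMean_prod_finset q {i} (fun _ => g)

theorem bernMean_add (q : ι → ℝ) (f g : (ι → Bool) → ℝ) :
    bernMean q (fun a => f a + g a) = bernMean q f + bernMean q g := by
  simp [bernMean, mul_add, Finset.sum_add_distrib]

theorem bernMean_sub (q : ι → ℝ) (f g : (ι → Bool) → ℝ) :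
    bernMean q (fun a => f a - g a) = bernMean q f - bernMean q g := by
  simp [bernMean, mul_sub, Finset.sum_sub_distrib]

theorem bernMean_const_mul (q : ι → ℝ) (c : ℝ) (f : (ι → Bool) → ℝ) :
    bernMean q (fun a => c * f a) = c * bernMean q f := by
  simp [bernMean, Finset.mul_sum, mul_left_comm]

theorem bernMean_mul_const (q : ι → ℝ) (c : ℝ) (f : (ι → Bool) → ℝ) :
    bernMean q (fun a => f a * c) = bernMean q f * c := by
  simp [bernMean, Finset.sum_mul, mul_assoc]

theorem bernMean_sum (q : ι → ℝ) {κ : Type*} (S : Finset κ) (f : κ → (ι → Bool) → ℝ) :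
    bernMean q (fun a => ∑ k ∈ S, f k a) = ∑ k ∈ S, bernMean q (f k) := by
  simp only [bernMean, Finset.mul_sum]
  exact Finset.sum_comm

theorem bernMean_mono {q : ι → ℝ} (h0 : ∀ i, 0 ≤ q i) (h1 : ∀ i, q i ≤ 1)
    {f g : (ι → Bool) → ℝ} (h : ∀ a, f a ≤ g a) : bernMean q f ≤ bernMean q g :=
  Finset.sum_le_sum fun a _ => mul_le_mul_of_nonneg_left (h a) (bernWeight_nonneg h0 h1 a)

theorem bernMean_nonneg {q : ι → ℝ} (h0 : ∀ i, 0 ≤ q i) (h1 : ∀ i, q i ≤ 1)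
    {f : (ι → Bool) → ℝ} (h : ∀ a, 0 ≤ f a) : 0 ≤ bernMean q f :=
  Finset.sum_nonneg fun a _ => mul_nonneg (bernWeight_nonneg h0 h1 a) (h a)

/-- Exchanging the coordinates outside `S` of two independent copies does not change the
expectation. -/
theorem bernMean_swap (q : ι → ℝ) (S : Finset ι) (h : (ι → Bool) → (ι → Bool) → ℝ) :
    bernMean q (fun x => bernMean q (h x)) =
      bernMean q (fun x => bernMean q (fun y => h (S.piecewise x y) (S.piecewise y x))) := by
  simp only [bernMean, Finset.mul_sum, ← mul_assoc]
  rw [← Fintype.sum_prod_type' (f := fun x y => bernWeight q x * bernWeight q y * h x y),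
    ← Fintype.sum_prod_type' (f := fun x y => bernWeight q x * bernWeight q y *
      h (S.piecewise x y) (S.piecewise y x))]
  have hinv : Function.Involutive
      (fun z : (ι → Bool) × (ι → Bool) => (S.piecewise z.1 z.2, S.piecewise z.2 z.1)) := by
    rintro ⟨x, y⟩
    ext i <;> by_cases hi : i ∈ S <;> simp [hi]
  symm
  refine Fintype.sum_equiv hinv.toPerm _ _ fun z => ?_
  simp only [Function.Involutive.coe_toPerm]
  congr 1
  simp only [bernWeight, ← Finset.prod_mul_distrib]
  refine Finset.prod_congr rfl fun i _ => ?_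
  by_cases hi : i ∈ S <;> simp [hi, mul_comm]

/-- Conditioning on all coordinates but `i`: in `bernMean_swap` with every other coordinate kept,
the second copy only supplies coordinate `i`. -/
theorem bernMean_resample (q : ι → ℝ) (i : ι) (f : (ι → Bool) → ℝ) :
    bernMean q f = bernMean q (fun a => q i * f (Function.update a i true)
      + (1 - q i) * f (Function.update a i false)) := by
  have h := bernMean_swap q (Finset.univ.erase i) (fun x _ => f x)
  simp only [bernMean_const] at h
  rw [h]
  congr 1
  ext x
  rw [← bernMean_apply q i (fun b => f (Function.update x i b))]
  congr 1
  ext y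
  congr 1
  ext j
  by_cases hj : j = i
  · subst hj; simp
  · simp [hj]

theorem bernMean_agree (q : ι → ℝ) (S : Finset ι) (y : ι → Bool) :
    bernMean q (fun a => if ∀ i ∈ S, a i = y i then 1 else 0) = ∏ i ∈ S, bernMass (q i) (y i) := by
  have h := bernMean_prod_finset q S (fun i b => if b = y i then 1 else 0)
  simp only [Finset.prod_boole] at h
  refine (Eq.trans (by congr!) h).trans ?_
  refine Finset.prod_congr rfl fun i _ => ?_
  cases y i <;> simp [bernMass]

/-- Two nonnegative functions that share few coordinates are almost uncorrelated. -/
theorem bernMean_mul_le {q : ι → ℝ} {c : ℝ} (hc : 0 < c) (h0 : ∀ i, c ≤ q i)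
    (h1 : ∀ i, c ≤ 1 - q i) (F G : Finset ι) {f g : (ι → Bool) → ℝ}
    (hf0 : ∀ a, 0 ≤ f a) (hg0 : ∀ a, 0 ≤ g a)
    (hf : ∀ a b, (∀ i ∈ F, a i = b i) → f a = f b)
    (hg : ∀ a b, (∀ i ∈ G, a i = b i) → g a = g b) :
    c ^ (F ∩ G).card * bernMean q (fun a => f a * g a) ≤ bernMean q f * bernMean q g := by
  have q0 : ∀ i, 0 ≤ q i := fun i => hc.le.trans (h0 i)
  have q1 : ∀ i, q i ≤ 1 := fun i => by linarith [h1 i]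
  have key : bernMean q f * bernMean q g = bernMean q (fun x => bernMean q (fun y => f x * g y)) := by
    simp only [bernMean_const_mul, bernMean_mul_const]
  have hmass : ∀ i b, c ≤ bernMass (q i) b := by
    intro i b; unfold bernMass; split_ifs
    exacts [h0 i, h1 i]
  calc c ^ (F ∩ G).card * bernMean q (fun a => f a * g a)
      = bernMean q (fun a => c ^ (F ∩ G).card * (f a * g a)) := (bernMean_const_mul _ _ _).symm
    -- An independent copy `y` agrees with a given `x` on `F ∩ G` with probability at least `c ^ |F
    -- ∩ G|`.
    _ ≤ bernMean q (fun x => bernMean q (fun y =>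
          (if ∀ i ∈ F ∩ G, y i = x i then 1 else 0) * (f x * g x))) := by
        refine bernMean_mono q0 q1 fun x => ?_
        rw [bernMean_mul_const, bernMean_agree]
        refine mul_le_mul_of_nonneg_right ?_ (mul_nonneg (hf0 x) (hg0 x))
        rw [← Finset.prod_const]
        exact Finset.prod_le_prod (fun _ _ => hc.le) (fun i _ => hmass i _)
    _ = bernMean q (fun x => bernMean q (fun y =>
          (if ∀ i ∈ F ∩ G, y i = x i then 1 else 0) * (f x * g y))) := by
        -- When the copies agree on `F ∩ G`, the configuration equal to `x` on `F` and to `y`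
        -- elsewhere has the `f`-value of `x` and the `g`-value of `y`. This decouples the product.
        rw [bernMean_swap q F]
        congr 1; ext x; congr 1; ext y
        have e : (∀ i ∈ F ∩ G, F.piecewise y x i = F.piecewise x y i) ↔
            ∀ i ∈ F ∩ G, y i = x i := by
          refine forall₂_congr fun i hi => ?_
          simp [(Finset.mem_inter.1 hi).1]
        simp only [e]
        split_ifs with hxy
        · rw [hf (F.piecewise x y) x, hg (F.piecewise x y) y]
          · intro i hi
            by_cases hF : i ∈ F
            · simpa [hF] using (hxy i (Finset.mem_inter.2 ⟨hF, hi⟩)).symm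
            · simp [hF]
          · intro i hi; simp [hi]
        · simp
    _ ≤ bernMean q (fun x => bernMean q (fun y => f x * g y)) := by
        refine bernMean_mono q0 q1 fun x => bernMean_mono q0 q1 fun y => ?_
        refine mul_le_of_le_one_left (mul_nonneg (hf0 x) (hg0 y)) ?_
        split_ifs <;> norm_num
    _ = _ := key.symm

/-- Second moment method. -/
theorem bernMean_exists_ge {q : ι → ℝ} (q0 : ∀ i, 0 ≤ q i) (q1 : ∀ i, q i ≤ 1)
    {κ : Type*} (S : Finset κ) (f : κ → (ι → Bool) → ℝ)
    (hf : ∀ k ∈ S, ∀ a, f k a = 0 ∨ f k a = 1) {C : ℝ} (hC : 0 ≤ C)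
    (hcor : ∀ k ∈ S, ∀ l ∈ S, k ≠ l →
      bernMean q (fun a => f k a * f l a) ≤ C * (bernMean q (f k) * bernMean q (f l)))
    (hone : 1 ≤ ∑ k ∈ S, bernMean q (f k)) (g : (ι → Bool) → ℝ)
    (hg0 : ∀ a, 0 ≤ g a) (hg : ∀ k ∈ S, ∀ a, f k a = 1 → 1 ≤ g a) :
    1 / (1 + C) ≤ bernMean q g := by
  classical
  set m := ∑ k ∈ S, bernMean q (f k) with hm
  set N : (ι → Bool) → ℝ := fun a => ∑ k ∈ S, f k a with hN
  have hEN : bernMean q N = m := bernMean_sum _ _ _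
  have hfm : ∀ k ∈ S, 0 ≤ bernMean q (f k) := fun k hk => bernMean_nonneg q0 q1 fun a => by
    rcases hf k hk a with h | h <;> simp [h]
  have hEN2 : bernMean q (fun a => N a * N a) ≤ (1 + C) * m ^ 2 := by
    have e : (fun a => N a * N a) = fun a => ∑ k ∈ S, ∑ l ∈ S, f k a * f l a := by
      ext a; simp only [hN]; rw [Finset.sum_mul_sum]
    rw [e, bernMean_sum]
    simp only [bernMean_sum]
    have : ∀ k ∈ S, ∑ l ∈ S, bernMean q (fun a => f k a * f l a) ≤
        bernMean q (f k) + C * (bernMean q (f k) * m) := by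
      intro k hk
      have : ∀ l ∈ S, bernMean q (fun a => f k a * f l a) ≤
          (if l = k then bernMean q (f k) else 0) + C * (bernMean q (f k) * bernMean q (f l)) := by
        intro l hl
        split_ifs with hlk
        · subst hlk
          have : (fun a => f l a * f l a) = f l := by
            ext a; rcases hf l hl a with h | h <;> simp [h]
          rw [this]
          have := mul_nonneg hC (mul_nonneg (hfm l hl) (hfm l hl))
          linarith
        · rw [zero_add]
          exact hcor k hk l hl (Ne.symm hlk)
      refine (Finset.sum_le_sum this).trans_eq ?_
      rw [Finset.sum_add_distrib, Finset.sum_ite_eq' S k, if_pos hk, ← Finset.mul_sum,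
        ← Finset.mul_sum]
    refine (Finset.sum_le_sum this).trans ?_
    rw [Finset.sum_add_distrib, ← Finset.mul_sum, ← Finset.sum_mul, ← hm]
    nlinarith
  have hmpos : 0 < m := by linarith
  -- The parabola `2tN - t²N²` is at most 1 and vanishes at `N = 0`, so it lies below the indicator
  -- of `N ≠ 0`. This `t` maximizes the resulting bound `2tm - t²(1 + C)m²`.
  set t := 1 / ((1 + C) * m) with ht
  have hbound : ∀ a, 2 * t * N a - t ^ 2 * (N a * N a) ≤ g a := by
    intro a
    by_cases hz : ∃ k ∈ S, f k a = 1
    · obtain ⟨k, hk, hka⟩ := hz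
      have := hg k hk a hka
      nlinarith [sq_nonneg (1 - t * N a)]
    · push Not at hz
      have : N a = 0 := Finset.sum_eq_zero fun k hk => (hf k hk a).resolve_right (hz k hk)
      rw [this]
      simpa using hg0 a
  have := bernMean_mono q0 q1 hbound
  rw [bernMean_sub, bernMean_const_mul, bernMean_const_mul, hEN] at this
  refine le_trans ?_ this
  have h2 : t ^ 2 * bernMean q (fun a => N a * N a) ≤ t ^ 2 * ((1 + C) * m ^ 2) :=
    mul_le_mul_of_nonneg_left hEN2 (sq_nonneg _)
  have h3 : 2 * t * m - t ^ 2 * ((1 + C) * m ^ 2) = 1 / (1 + C) := by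
    rw [ht]; field_simp; ring
  linarith

theorem bernMean_markov {q : ι → ℝ} (q0 : ∀ i, 0 ≤ q i) (q1 : ∀ i, q i ≤ 1)
    {f : (ι → Bool) → ℝ} (hf : ∀ a, 0 ≤ f a) {T : ℝ} (hT : 0 < T) (h : bernMean q f ≤ T) :
    1 / 2 ≤ bernMean q (fun a => if f a ≤ 2 * T then 1 else 0) := by
  have hb : ∀ a, 1 - (1 / (2 * T)) * f a ≤ (if f a ≤ 2 * T then (1 : ℝ) else 0) := by
    intro a
    split_ifs with ha
    · have := mul_nonneg (by positivity : (0 : ℝ) ≤ 1 / (2 * T)) (hf a)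
      linarith
    · push Not at ha
      have : 1 ≤ 1 / (2 * T) * f a := by
        rw [one_div, ← div_eq_inv_mul, le_div_iff₀ (by positivity)]; linarith
      linarith
  have := bernMean_mono q0 q1 hb
  rw [bernMean_sub, bernMean_const, bernMean_const_mul] at this
  have h2 : 1 / (2 * T) * bernMean q f ≤ 1 / (2 * T) * T :=
    mul_le_mul_of_nonneg_left h (by positivity)
  have h3 : 1 / (2 * T) * T = 1 / 2 := by field_simp
  linarith

/-! ### Binomial and Chernoff estimates -/

/-- Squared form of `4^n / (2√n) ≤ C(2n, n)`, which avoids roots. The induction step reduces to `(2n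
+ 1)² ≥ 4n(n + 1)`. -/
theorem sixteen_pow_le_centralBinom_sq {n : ℕ} (hn : 1 ≤ n) :
    (16 : ℝ) ^ n ≤ 4 * n * (n.centralBinom : ℝ) ^ 2 := by
  induction n, hn using Nat.le_induction with
  | base => norm_num [Nat.centralBinom, Nat.choose]
  | succ n hn ih =>
    have h : ((n : ℝ) + 1) * (n + 1).centralBinom = 2 * (2 * n + 1) * n.centralBinom := by
      exact_mod_cast Nat.succ_mul_centralBinom_succ n
    set c : ℝ := (n.centralBinom : ℝ)
    set c' : ℝ := ((n + 1).centralBinom : ℝ)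
    have hn0 : (0 : ℝ) < (n : ℝ) + 1 := by positivity
    push_cast
    have h2 : ((n : ℝ) + 1) ^ 2 * c' ^ 2 = 4 * (2 * n + 1) ^ 2 * c ^ 2 := by
      rw [← mul_pow, h]; ring
    have h3 : ((n : ℝ) + 1) * 16 ^ (n + 1) ≤ ((n : ℝ) + 1) * (4 * (n + 1) * c' ^ 2) := by
      have : ((n : ℝ) + 1) * (4 * (n + 1) * c' ^ 2) = 16 * (2 * n + 1) ^ 2 * c ^ 2 := by
        linear_combination 4 * h2
      rw [this, pow_succ]
      have : 16 * ((n : ℝ) + 1) * 16 ^ n ≤ 16 * ((n : ℝ) + 1) * (4 * n * c ^ 2) :=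
        mul_le_mul_of_nonneg_left ih (by positivity)
      nlinarith [sq_nonneg c]
    exact le_of_mul_le_mul_left h3 hn0

/-- The probability of exactly `D` successes in `2 D` Bernoulli trials. -/
theorem bernMean_balanced (p : ℝ) (F : Finset ι) {D : ℕ} (hF : F.card = 2 * D) :
    bernMean (fun _ => p) (fun a => if (F.filter fun i => a i = true).card = D then 1 else 0) =
      D.centralBinom * (p * (1 - p)) ^ D := by
  -- Split according to the exact set `T` of successes.
  have e : (fun a : ι → Bool => if (F.filter fun i => a i = true).card = D then (1 : ℝ) else 0) =
      fun a => ∑ T ∈ F.powersetCard D, if ∀ i ∈ F, a i = decide (i ∈ T) then 1 else 0 := by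
    ext a
    have h : ∀ T ∈ F.powersetCard D, ((∀ i ∈ F, a i = decide (i ∈ T)) ↔
        T = F.filter fun i => a i = true) := by
      intro T hT
      have hTF := (Finset.mem_powersetCard.1 hT).1
      constructor
      · intro h; ext i
        simp only [Finset.mem_filter]
        constructor
        · intro hi; exact ⟨hTF hi, by rw [h i (hTF hi)]; simpa using hi⟩
        · rintro ⟨hi, hai⟩; rw [h i hi] at hai; simpa using hai
      · rintro rfl i hi
        simp [hi]
    rw [Finset.sum_congr rfl fun T hT => by rw [if_congr (h T hT) rfl rfl]]
    rw [Finset.sum_ite_eq']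
    simp [Finset.mem_powersetCard]
  rw [e, bernMean_sum]
  have h : ∀ T ∈ F.powersetCard D, bernMean (fun _ : ι => p)
      (fun a => if ∀ i ∈ F, a i = decide (i ∈ T) then 1 else 0) = (p * (1 - p)) ^ D := by
    intro T hT
    obtain ⟨hTF, hTc⟩ := Finset.mem_powersetCard.1 hT
    rw [bernMean_agree (fun _ => p) F (fun i => decide (i ∈ T))]
    rw [← Finset.prod_sdiff hTF]
    have h1 : ∏ i ∈ T, bernMass p (decide (i ∈ T)) = p ^ D := by
      rw [← hTc]
      exact Finset.prod_eq_pow_card fun i hi => by simp [bernMass, hi]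
    have h2 : ∏ i ∈ F \ T, bernMass p (decide (i ∈ T)) = (1 - p) ^ D := by
      have : (F \ T).card = D := by rw [Finset.card_sdiff_of_subset hTF]; omega
      rw [← this]
      exact Finset.prod_eq_pow_card fun i hi => by simp [bernMass, (Finset.mem_sdiff.1 hi).2]
    rw [h1, h2, mul_pow, mul_comm]
  rw [Finset.sum_congr rfl h, Finset.sum_const, Finset.card_powersetCard, hF, nsmul_eq_mul]
  rfl

/-- Since `p(1 - p) = (1 - 4δ²)/4`, the power `4^D` from the central binomial cancels, and `1 - 4δ²
≥ exp(-8δ²)` for `δ² ≤ 1/8`. A common bound `K ≥ 1` in place of `D` makes the estimate uniform and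
covers `D = 0`. -/
theorem exp_le_bernMean_balanced {δ K : ℝ} (hδ : δ ^ 2 ≤ 1 / 8) (F : Finset ι) {D : ℕ}
    (hF : F.card = 2 * D) (hK : (D : ℝ) ≤ K) (hK1 : 1 ≤ K) :
    Real.exp (-(4 * δ ^ 2 * F.card)) / (2 * Real.sqrt K) ≤ bernMean (fun _ => 1 / 2 - δ)
      (fun a => if (F.filter fun i => a i = true).card = D then 1 else 0) := by
  rw [bernMean_balanced _ _ hF]
  have hsq : 1 ≤ Real.sqrt K := Real.one_le_sqrt.2 hK1
  have h1 : (4 : ℝ) ^ D / (2 * Real.sqrt K) ≤ D.centralBinom := by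
    rw [div_le_iff₀ (by positivity)]
    rcases Nat.eq_zero_or_pos D with rfl | hD
    · simp; linarith
    · refine abs_le_of_sq_le_sq' ?_ (by positivity) |>.2
      have := sixteen_pow_le_centralBinom_sq hD
      rw [mul_pow, mul_pow, Real.sq_sqrt (by linarith), ← pow_mul, mul_comm D 2, pow_mul]
      norm_num
      nlinarith [sq_nonneg (D.centralBinom : ℝ)]
  have h2 : Real.exp (-(4 * δ ^ 2 * F.card)) ≤ (1 - 4 * δ ^ 2) ^ D := by
    have h3 : Real.exp (-(8 * δ ^ 2)) ≤ 1 - 4 * δ ^ 2 := by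
      have hy : 1 + 8 * δ ^ 2 ≤ Real.exp (8 * δ ^ 2) := by
        linarith [Real.add_one_le_exp (8 * δ ^ 2)]
      rw [Real.exp_neg, inv_le_comm₀ (Real.exp_pos _) (by linarith)]
      refine le_trans ?_ hy
      rw [inv_le_iff_one_le_mul₀ (by linarith)]
      nlinarith [sq_nonneg δ]
    calc Real.exp (-(4 * δ ^ 2 * F.card)) = Real.exp (-(8 * δ ^ 2)) ^ D := by
          rw [← Real.exp_nat_mul, hF]; push_cast; ring_nf
      _ ≤ _ := pow_le_pow_left₀ (Real.exp_pos _).le h3 D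
  calc Real.exp (-(4 * δ ^ 2 * F.card)) / (2 * Real.sqrt K)
      ≤ (1 - 4 * δ ^ 2) ^ D / (2 * Real.sqrt K) := by gcongr
    _ = 4 ^ D / (2 * Real.sqrt K) * ((1 / 2 - δ) * (1 - (1 / 2 - δ))) ^ D := by
        rw [div_mul_eq_mul_div, ← mul_pow]; congr 2; ring
    _ ≤ _ := by
        refine mul_le_mul_of_nonneg_right h1 (pow_nonneg ?_ _)
        nlinarith

/-- The left side is `cosh δ - 2δ sinh δ`, with `cosh δ ≤ 1 + δ²` and `sinh δ ≥ δ`. It is the moment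
generating factor of one trial in the Chernoff bound with tilt `δ`. -/
theorem cosh_sub_sinh_le {δ : ℝ} (h0 : 0 ≤ δ) (h1 : δ ≤ 1 / 2) :
    (1 / 2 - δ) * Real.exp δ + (1 - (1 / 2 - δ)) * Real.exp (-δ) ≤ 1 - δ ^ 2 := by
  have hc : Real.cosh δ ≤ 1 + δ ^ 2 := by
    refine (Real.cosh_le_exp_half_sq δ).trans ?_
    have := Real.abs_exp_sub_one_sub_id_le (x := δ ^ 2 / 2) (by
      rw [abs_of_nonneg (by positivity)]; nlinarith)
    have := (abs_le.1 this).2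
    have h2 : δ ^ 2 ≤ 1 / 4 := by nlinarith
    nlinarith [mul_nonneg (sq_nonneg δ) (sub_nonneg.2 h2)]
  have hs : δ ≤ Real.sinh δ := Real.self_le_sinh_iff.2 h0
  rw [Real.cosh_eq] at hc
  rw [Real.sinh_eq] at hs
  nlinarith

/-- Chernoff bound: a majority of successes among Bernoulli trials of parameter `1 / 2 - δ`. -/
theorem bernMean_majority_le {δ : ℝ} (h0 : 0 ≤ δ) (h1 : δ ≤ 1 / 2) (F : Finset ι) :
    bernMean (fun _ => 1 / 2 - δ)
      (fun x => if ∑ e ∈ F, (1 - 2 * (if x e then (1 : ℝ) else 0)) ≤ 0 then 1 else 0) ≤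
      (1 - δ ^ 2) ^ F.card := by
  have hb := bernMean_mono (q := fun _ : ι => 1 / 2 - δ) (fun _ => by linarith) (fun _ => by linarith)
    (f := fun x => if ∑ e ∈ F, (1 - 2 * (if x e then (1 : ℝ) else 0)) ≤ 0 then 1 else 0)
    (g := fun x => ∏ e ∈ F, Real.exp (-(δ * (1 - 2 * (if x e then (1 : ℝ) else 0))))) (fun x => by
      rw [← Real.exp_sum]
      split_ifs with h
      · refine Real.one_le_exp ?_
        rw [Finset.sum_neg_distrib, ← Finset.mul_sum]
        nlinarith
      · positivity)
  refine hb.trans ?_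
  rw [bernMean_prod_finset (fun _ => 1 / 2 - δ) F
    (fun _ b => Real.exp (-(δ * (1 - 2 * (if b then (1 : ℝ) else 0))))), Finset.prod_const]
  refine pow_le_pow_left₀ ?_ ?_ _
  · have : 0 ≤ 1 / 2 - δ := by linarith
    have : 0 ≤ 1 - (1 / 2 - δ) := by linarith
    positivity
  · refine le_trans (le_of_eq ?_) (cosh_sub_sinh_le h0 h1)
    simp only [if_true, Bool.false_eq_true, if_false]
    ring_nf

/-- Along a map `τ` that leaves `M`, the coordinates in `M` often disagree with their images. -/
theorem bernMean_disagree_le {q : ι → ℝ} (q0 : ∀ i, 0 ≤ q i) (q1 : ∀ i, q i ≤ 1)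
    {β ρ : ℝ} (hβ : β ≤ 1 / 2) (hρ0 : 0 ≤ ρ) (hρ1 : ρ ≤ 1) (τ : ι → ι) (M : Finset ι)
    (hq : ∀ e ∈ M, q e = β) (hτ : ∀ e ∈ M, τ e ∉ M) :
    bernMean q (fun a => ∏ e ∈ M, if a (τ e) ≠ a e then ρ else 1) ≤
      (1 - (1 - ρ) * β) ^ M.card := by
  induction M using Finset.induction_on with
  | empty => simp [bernMean_const]
  | insert e M he ih =>
    have ih' := ih (fun e' h => hq e' (Finset.mem_insert_of_mem h))
      (fun e' h h' => hτ e' (Finset.mem_insert_of_mem h) (Finset.mem_insert_of_mem h'))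
    have hβ0 : 0 ≤ β := hq e (Finset.mem_insert_self _ _) ▸ q0 e
    have hpos : 0 ≤ 1 - (1 - ρ) * β := by nlinarith
    rw [Finset.card_insert_of_notMem he, pow_succ']
    refine le_trans ?_ (mul_le_mul_of_nonneg_left ih' hpos)
    -- Neither `τ e` nor any pair in the other factors involves coordinate `e`. Given the rest, `a
    -- e` differs from `a (τ e)` with probability `β` or `1 - β`, hence at least `β` because `β ≤
    -- 1/2`.
    rw [bernMean_resample q e, ← bernMean_const_mul]
    refine bernMean_mono q0 q1 fun a => ?_
    have hτe : τ e ≠ e := fun h =>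
      hτ e (Finset.mem_insert_self _ _) (by rw [h]; exact Finset.mem_insert_self _ _)
    have hinv : ∀ b, ∏ e' ∈ M, (if Function.update a e b (τ e') ≠ Function.update a e b e'
        then ρ else 1) = ∏ e' ∈ M, if a (τ e') ≠ a e' then ρ else 1 := by
      intro b
      refine Finset.prod_congr rfl fun e' he' => ?_
      have h1 : e' ≠ e := fun h => he (h ▸ he')
      have h2 : τ e' ≠ e := fun h =>
        hτ e' (Finset.mem_insert_of_mem he') (by rw [h]; exact Finset.mem_insert_self _ _)
      rw [Function.update_of_ne h1, Function.update_of_ne h2]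
    have hP : 0 ≤ ∏ e' ∈ M, if a (τ e') ≠ a e' then ρ else 1 :=
      Finset.prod_nonneg fun e' _ => by split_ifs <;> linarith
    simp only [Finset.prod_insert he, hinv, Function.update_self, Function.update_of_ne hτe,
      hq e (Finset.mem_insert_self _ _)]
    rw [← mul_assoc, ← mul_assoc, ← add_mul]
    refine mul_le_mul_of_nonneg_right ?_ hP
    cases a (τ e) <;> simp <;> nlinarith

/-- Coordinates with common parameter 1 almost surely agree. With common parameter `β`, a
disagreement forces one of them to be true, which costs `2β`. Unequal parameters get the trivial
bound 1. -/
theorem bernMean_ne_le {q : ι → ℝ} (q0 : ∀ i, 0 ≤ q i) (q1 : ∀ i, q i ≤ 1) (i j : ι) {β : ℝ}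
    (hβ : 0 ≤ β)
    (h : q i = q j → q i = 1 ∨ q i = β) :
    bernMean q (fun a => if a i ≠ a j then 1 else 0) ≤ (if q i ≠ q j then 1 else 0) + 2 * β := by
  by_cases hij : q i = q j
  · rw [if_neg (by simpa using hij), zero_add]
    rcases h hij with h1 | h1
    · have hb := bernMean_mono q0 q1 (f := fun a => if a i ≠ a j then (1 : ℝ) else 0)
        (g := fun a => (if a i then 0 else 1) + (if a j then 0 else 1)) (fun a => by
          cases a i <;> cases a j <;> simp)
      rw [bernMean_add, bernMean_apply q i (fun b => if b then 0 else 1),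
        bernMean_apply q j (fun b => if b then 0 else 1), ← hij, h1] at hb
      simp at hb ⊢
      linarith
    · have hb := bernMean_mono q0 q1 (f := fun a => if a i ≠ a j then (1 : ℝ) else 0)
        (g := fun a => (if a i then 1 else 0) + (if a j then 1 else 0)) (fun a => by
          cases a i <;> cases a j <;> simp)
      rw [bernMean_add, bernMean_apply q i (fun b => if b then 1 else 0),
        bernMean_apply q j (fun b => if b then 1 else 0), ← hij, h1] at hb
      simp at hb ⊢
      linarith
  · rw [if_pos hij]
    have hb := bernMean_mono q0 q1 (f := fun a => if a i ≠ a j then (1 : ℝ) else 0)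
        (g := fun a => 1) (fun a => by split_ifs <;> simp)
    rw [bernMean_const] at hb
    linarith

end BernoulliMean

/-! ### Graphs as Boolean functions on vertex pairs -/

section VertexPairs

variable {n : ℕ}

/-- The pairs of distinct vertices, represented with increasing entries. -/
abbrev VertexPair (n : ℕ) : Type := {e : Fin n × Fin n // e.1 < e.2}

/-- The unordered pair of two distinct vertices. -/
def mkPair (i j : Fin n) (h : i ≠ j) : VertexPair n :=
  if h' : i < j then ⟨(i, j), h'⟩ else ⟨(j, i), lt_of_le_of_ne (not_lt.1 h') h.symm⟩

theorem mkPair_comm (i j : Fin n) (h : i ≠ j) : mkPair i j h = mkPair j i h.symm := by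
  unfold mkPair
  rcases lt_or_gt_of_ne h with h' | h' <;> simp [h', h'.not_gt]

theorem mkPair_self (e : VertexPair n) : mkPair e.1.1 e.1.2 e.2.ne = e := by
  simp [mkPair, e.2]

theorem mkPair_cases (i j : Fin n) (h : i ≠ j) :
    ((mkPair i j h).1.1 = i ∧ (mkPair i j h).1.2 = j) ∨
      ((mkPair i j h).1.1 = j ∧ (mkPair i j h).1.2 = i) := by
  unfold mkPair
  split_ifs <;> simp

/-- Adjacency in the graph with edge indicator `a`. -/
def adj (a : VertexPair n → Bool) (i j : Fin n) : Bool :=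
  if h : i ≠ j then a (mkPair i j h) else false

theorem adj_of_ne (a : VertexPair n → Bool) {i j : Fin n} (h : i ≠ j) :
    adj a i j = a (mkPair i j h) := by
  simp [adj, h]

theorem adj_self (a : VertexPair n → Bool) (i : Fin n) : adj a i i = false := by
  simp [adj]

theorem adj_comm (a : VertexPair n → Bool) (i j : Fin n) : adj a i j = adj a j i := by
  by_cases h : i = j
  · subst h; rfl
  · rw [adj_of_ne a h, adj_of_ne a (Ne.symm h), mkPair_comm]

theorem adj_pair (a : VertexPair n → Bool) (e : VertexPair n) : adj a e.1.1 e.1.2 = a e := by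
  rw [adj_of_ne a e.2.ne, mkPair_self]

/-- The adjacency matrix of the graph with edge indicator `a`. -/
def graphMatrix (a : VertexPair n → Bool) : Matrix (Fin n) (Fin n) ℝ :=
  Matrix.of fun i j => if adj a i j then 1 else 0

theorem graphMatrix_apply (a : VertexPair n → Bool) (i j : Fin n) :
    graphMatrix a i j = if adj a i j then 1 else 0 := rfl

theorem graphMatrix_pair (a : VertexPair n → Bool) (e : VertexPair n) :
    graphMatrix a e.1.1 e.1.2 = if a e then 1 else 0 := by
  rw [graphMatrix_apply, adj_pair]

theorem eq_graphMatrix_iff {M : Matrix (Fin n) (Fin n) ℝ} (hs : ∀ i j, M i j = M j i)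
    (hh : ∀ i, M i i = 0) (a : VertexPair n → Bool) :
    M = graphMatrix a ↔ ∀ e : VertexPair n, M e.1.1 e.1.2 = if a e then 1 else 0 := by
  constructor
  · rintro rfl e
    exact graphMatrix_pair a e
  · intro h
    have key : ∀ i j, i < j → M i j = graphMatrix a i j := fun i j hij => by
      have := h ⟨(i, j), hij⟩
      rw [← graphMatrix_pair] at this
      exact this
    ext i j
    rcases lt_trichotomy i j with hij | rfl | hij
    · exact key i j hij
    · rw [hh, graphMatrix_apply, adj_self]; simp
    · rw [hs, key j i hij, graphMatrix_apply, graphMatrix_apply, adj_comm]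

/-- The action of a permutation of the vertices on pairs. -/
def pairMap (s : Equiv.Perm (Fin n)) (e : VertexPair n) : VertexPair n :=
  mkPair (s e.1.1) (s e.1.2) (s.injective.ne e.2.ne)

theorem adj_perm (a : VertexPair n → Bool) (s : Equiv.Perm (Fin n)) (e : VertexPair n) :
    adj a (s e.1.1) (s e.1.2) = a (pairMap s e) :=
  adj_of_ne a _

theorem sum_eq_two_mul_sum_pair (f : Fin n → Fin n → ℝ) (hs : ∀ i j, f i j = f j i)
    (hd : ∀ i, f i i = 0) : ∑ i, ∑ j, f i j = 2 * ∑ e : VertexPair n, f e.1.1 e.1.2 := by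
  have h1 : ∑ e : VertexPair n, f e.1.1 e.1.2 = ∑ i, ∑ j, if i < j then f i j else 0 := by
    rw [← Fintype.sum_prod_type' (f := fun i j => if i < j then f i j else 0),
      ← Finset.sum_filter]
    exact (Finset.sum_subtype _ (fun x => by simp) (fun x : Fin n × Fin n => f x.1 x.2)).symm
  have h2 : ∑ i, ∑ j, (if i < j then f i j else 0) = ∑ i, ∑ j, if j < i then f i j else 0 := by
    rw [Finset.sum_comm]
    exact Finset.sum_congr rfl fun i _ => Finset.sum_congr rfl fun j _ => by rw [hs]
  rw [two_mul]
  nth_rewrite 2 [h1]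
  rw [h1, h2]
  nth_rewrite 1 [← h2]
  simp only [← Finset.sum_add_distrib]
  refine Finset.sum_congr rfl fun i _ => Finset.sum_congr rfl fun j _ => ?_
  rcases lt_trichotomy i j with hij | rfl | hij
  · simp [hij, hij.not_gt]
  · simp [hd]
  · simp [hij, hij.not_gt]

end VertexPairs

/-! ### The matching objective relative to the true permutation -/

section Objective

variable {n : ℕ}

theorem frobenius_norm_sq (M : Matrix (Fin n) (Fin n) ℝ) : ‖M‖ ^ 2 = ∑ i, ∑ j, M i j ^ 2 := by
  rw [Matrix.frobenius_norm_def, ← Real.sqrt_eq_rpow, Real.sq_sqrt (by positivity)]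
  simp

theorem conj_permMatrix_apply (s : Equiv.Perm (Fin n)) (Y : Matrix (Fin n) (Fin n) ℝ)
    (i j : Fin n) :
    ((s.permMatrix ℝ)ᵀ * Y * s.permMatrix ℝ) i j = Y (s⁻¹ i) (s⁻¹ j) := by
  rw [Matrix.transpose_permMatrix]
  simp [Equiv.Perm.permMatrix, PEquiv.toMatrix_toPEquiv_mul,
    PEquiv.mul_toMatrix_toPEquiv]

/-- The objective of the graph matching problem at `P` times a permutation matrix. -/
def matchCost (A Y : Matrix (Fin n) (Fin n) ℝ) (s : Equiv.Perm (Fin n)) : ℝ :=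
  ∑ i, ∑ j, (A (s i) (s j) - Y i j) ^ 2

theorem permMatrix_mul_transpose (s : Equiv.Perm (Fin n)) :
    (s.permMatrix ℝ)ᵀ * s.permMatrix ℝ = 1 := by
  rw [Matrix.transpose_permMatrix, ← Matrix.permMatrix_mul]
  simp

/-- Writing candidates as the true matrix times another permutation matrix cancels the truth, which
then corresponds to `s = 1`. -/
theorem objective_eq (A Y : Matrix (Fin n) (Fin n) ℝ) (t s : Equiv.Perm (Fin n)) :
    ‖A - (t.permMatrix ℝ * s.permMatrix ℝ)ᵀ *
      (t.permMatrix ℝ * Y * (t.permMatrix ℝ)ᵀ) * (t.permMatrix ℝ * s.permMatrix ℝ)‖ ^ 2 =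
      matchCost A Y s := by
  have e : (t.permMatrix ℝ * s.permMatrix ℝ)ᵀ *
      (t.permMatrix ℝ * Y * (t.permMatrix ℝ)ᵀ) * (t.permMatrix ℝ * s.permMatrix ℝ) =
      (s.permMatrix ℝ)ᵀ * Y * s.permMatrix ℝ := by
    rw [Matrix.transpose_mul]
    calc _ = (s.permMatrix ℝ)ᵀ * ((t.permMatrix ℝ)ᵀ * t.permMatrix ℝ) * Y *
          ((t.permMatrix ℝ)ᵀ * t.permMatrix ℝ) * s.permMatrix ℝ := by
          simp only [Matrix.mul_assoc]
      _ = _ := by rw [permMatrix_mul_transpose]; simp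
  rw [e, frobenius_norm_sq, matchCost]
  rw [← Equiv.sum_comp s]
  refine Finset.sum_congr rfl fun i _ => ?_
  rw [← Equiv.sum_comp s]
  refine Finset.sum_congr rfl fun j _ => ?_
  rw [Matrix.sub_apply, conj_permMatrix_apply]
  simp

theorem exists_eq_mul_permMatrix {t : Equiv.Perm (Fin n)} {Q : Matrix (Fin n) (Fin n) ℝ}
    (hQ : Q ∈ permMatrices n) : ∃ s : Equiv.Perm (Fin n), Q = t.permMatrix ℝ * s.permMatrix ℝ := by
  obtain ⟨r, rfl⟩ := hQ
  refine ⟨r * t⁻¹, ?_⟩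
  rw [← Matrix.permMatrix_mul]
  simp

theorem mul_permMatrix_mem (t s : Equiv.Perm (Fin n)) :
    t.permMatrix ℝ * s.permMatrix ℝ ∈ permMatrices n :=
  ⟨s * t, by simp⟩

theorem mem_mleSet_iff (A Y : Matrix (Fin n) (Fin n) ℝ) (t s : Equiv.Perm (Fin n)) :
    t.permMatrix ℝ * s.permMatrix ℝ ∈ mleSet A (t.permMatrix ℝ * Y * (t.permMatrix ℝ)ᵀ) ↔
      ∀ r, matchCost A Y s ≤ matchCost A Y r := by
  simp only [mleSet, Set.mem_ofPred_eq, mul_permMatrix_mem, true_and]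
  constructor
  · intro h r
    rw [← objective_eq A Y t, ← objective_eq A Y t]
    exact h _ (mul_permMatrix_mem t r)
  · intro h Q hQ
    obtain ⟨r, rfl⟩ := exists_eq_mul_permMatrix (t := t) hQ
    rw [objective_eq, objective_eq]
    exact h r

theorem mleError_eq_zero {A Y P : Matrix (Fin n) (Fin n) ℝ} (hP : P ∈ permMatrices n)
    (h : ∀ s : Equiv.Perm (Fin n), s ≠ 1 → matchCost A Y 1 < matchCost A Y s) :
    mleError A (P * Y * Pᵀ) P = 0 := by
  obtain ⟨t, rfl⟩ := hP
  obtain ⟨Q, hQ, hQe⟩ := (mleError_isGreatest A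
    (t.permMatrix ℝ * Y * (t.permMatrix ℝ)ᵀ) (t.permMatrix ℝ)).1
  dsimp only at hQe ⊢
  rw [← hQe]
  obtain ⟨s, rfl⟩ := exists_eq_mul_permMatrix (t := t) hQ.1
  have hs : s = 1 := by
    by_contra hs
    exact absurd ((mem_mleSet_iff A Y t s).1 hQ 1) (not_le.2 (h s hs))
  subst hs
  simp

theorem one_le_norm_permMatrix_sub {r t : Equiv.Perm (Fin n)} (h : r ≠ t) :
    1 ≤ ‖r.permMatrix ℝ - t.permMatrix ℝ‖ := by
  obtain ⟨i, hi⟩ : ∃ i, r i ≠ t i := by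
    by_contra! hc
    exact h (Equiv.ext hc)
  have h1 : (1 : ℝ) ≤ ‖r.permMatrix ℝ - t.permMatrix ℝ‖ ^ 2 := by
    rw [frobenius_norm_sq]
    have e : ((r.permMatrix ℝ - t.permMatrix ℝ) i (r i)) ^ 2 = 1 := by
      simp [Equiv.Perm.permMatrix, PEquiv.toMatrix_apply, Matrix.sub_apply, Ne.symm hi]
    calc (1 : ℝ) = ((r.permMatrix ℝ - t.permMatrix ℝ) i (r i)) ^ 2 := e.symm
      _ ≤ ∑ j, ((r.permMatrix ℝ - t.permMatrix ℝ) i j) ^ 2 :=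
        Finset.single_le_sum (f := fun j => ((r.permMatrix ℝ - t.permMatrix ℝ) i j) ^ 2)
          (fun j _ => sq_nonneg _) (Finset.mem_univ (r i))
      _ ≤ _ := Finset.single_le_sum
          (f := fun i => ∑ j, ((r.permMatrix ℝ - t.permMatrix ℝ) i j) ^ 2)
          (fun j _ => Finset.sum_nonneg fun _ _ => sq_nonneg _) (Finset.mem_univ i)
  nlinarith [norm_nonneg (r.permMatrix ℝ - t.permMatrix ℝ)]

/-- A tie suffices because the error is the worst over all minimizers: if the identity is minimal
then so is `s`, and otherwise any minimizer is already wrong. -/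
theorem one_le_mleError {A Y P : Matrix (Fin n) (Fin n) ℝ} (hP : P ∈ permMatrices n)
    {s : Equiv.Perm (Fin n)} (hs : s ≠ 1) (h : matchCost A Y s ≤ matchCost A Y 1) :
    1 ≤ mleError A (P * Y * Pᵀ) P := by
  obtain ⟨t, rfl⟩ := hP
  obtain ⟨r, hr⟩ := Finite.exists_min (matchCost A Y)
  obtain ⟨r', hr', hr1⟩ : ∃ r', (∀ u, matchCost A Y r' ≤ matchCost A Y u) ∧ r' ≠ 1 := by
    by_cases hr1 : r = 1
    · exact ⟨s, fun u => h.trans (hr1 ▸ hr u), hs⟩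
    · exact ⟨r, hr, hr1⟩
  have hmem := (mem_mleSet_iff A Y t r').2 hr'
  refine le_trans ?_ ((mleError_isGreatest A (t.permMatrix ℝ * Y * (t.permMatrix ℝ)ᵀ)
    (t.permMatrix ℝ)).2 ⟨_, hmem, rfl⟩)
  dsimp only
  rw [← Matrix.permMatrix_mul]
  exact one_le_norm_permMatrix_sub fun hc => hr1 (by simpa using hc)

/-- The pairs on which the graph `a` and its image under `s` disagree. -/
def disagree (s : Equiv.Perm (Fin n)) (a : VertexPair n → Bool) : Finset (VertexPair n) :=
  Finset.univ.filter fun e => a (pairMap s e) ≠ a e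

theorem corrupt_eq (A X P : Matrix (Fin n) (Fin n) ℝ) :
    corrupt A X P = P * corrupt A X 1 * Pᵀ := by
  simp [corrupt]

/-- The noise flips the entry at `e` exactly when `x e` holds, so the identity pays `x e` there.
Where `a` and its image disagree, `s` pays `1 - x e`; elsewhere it pays the same as the identity.
The factor 2 counts both orderings of a pair. -/
theorem matchCost_sub (a x : VertexPair n → Bool) (s : Equiv.Perm (Fin n)) :
    matchCost (graphMatrix a) (corrupt (graphMatrix a) (graphMatrix x) 1) s -
      matchCost (graphMatrix a) (corrupt (graphMatrix a) (graphMatrix x) 1) 1 =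
      2 * ∑ e ∈ disagree s a, (1 - 2 * (if x e then (1 : ℝ) else 0)) := by
  have hY : ∀ i j, corrupt (graphMatrix a) (graphMatrix x) 1 i j =
      graphMatrix x i j * (1 - graphMatrix a i j) + (1 - graphMatrix x i j) * graphMatrix a i j := by
    intro i j; simp [corrupt]
  have hsymm : ∀ (b : VertexPair n → Bool) i j, graphMatrix b i j = graphMatrix b j i := by
    intro b i j; rw [graphMatrix_apply, graphMatrix_apply, adj_comm]
  rw [matchCost, matchCost, ← Finset.sum_sub_distrib]
  simp only [← Finset.sum_sub_distrib, hY]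
  rw [sum_eq_two_mul_sum_pair]
  · rw [disagree, Finset.sum_filter]
    congr 1
    refine Finset.sum_congr rfl fun e _ => ?_
    rw [graphMatrix_apply a (s _), adj_perm, Equiv.Perm.one_apply, Equiv.Perm.one_apply,
      graphMatrix_pair, graphMatrix_pair]
    cases a (pairMap s e) <;> cases a e <;> cases x e <;> norm_num
  · intro i j
    rw [hsymm a (s i) (s j), hsymm a i j, hsymm x i j,
      hsymm a ((1 : Equiv.Perm (Fin n)) i) ((1 : Equiv.Perm (Fin n)) j)]
  · intro i
    simp [graphMatrix_apply, adj_self]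

end Objective

/-! ### From the probability space to finite sums -/

section Transfer

variable {Ω : Type*} [MeasurableSpace Ω] {μ : Measure Ω} {n : ℕ}

theorem IsBernoulliGraph.measureReal_eq_graphMatrix [IsProbabilityMeasure μ]
    {Λ : Fin n → Fin n → I}
    {M : Ω → Matrix (Fin n) (Fin n) ℝ} (h : IsBernoulliGraph μ Λ M) (a : VertexPair n → Bool) :
    μ.real {ω | M ω = graphMatrix a} =
      bernWeight (fun e : VertexPair n => (Λ e.1.1 e.1.2 : ℝ)) a := by
  have e1 : {ω | M ω = graphMatrix a} = ⋂ e ∈ (Finset.univ : Finset (VertexPair n)),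
      (fun ω => M ω e.1.1 e.1.2) ⁻¹' {if a e then (1 : ℝ) else 0} := by
    ext ω
    simp only [Set.mem_ofPred_eq, eq_graphMatrix_iff (h.symm ω) (h.hollow ω)]
    simp
  rw [e1, measureReal_def, h.indep.measure_inter_preimage_eq_mul Finset.univ
    (sets := fun e => {if a e then (1 : ℝ) else 0}) (fun e _ => measurableSet_singleton _),
    ENNReal.toReal_prod]
  refine Finset.prod_congr rfl fun e _ => ?_
  have hl := h.law e.1.1 e.1.2 e.2
  rw [← Measure.map_apply_of_aemeasurable hl.aemeasurable (measurableSet_singleton _), hl.map_eq,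
    ← measureReal_def]
  cases a e
  · simp [bernMass]
  · simp [bernMass]

theorem IsBernoulliGraph.ae_exists {Λ : Fin n → Fin n → I} {M : Ω → Matrix (Fin n) (Fin n) ℝ}
    (h : IsBernoulliGraph μ Λ M) : ∀ᵐ ω ∂μ, ∃ a, M ω = graphMatrix a := by
  have h1 : ∀ e : VertexPair n, ∀ᵐ ω ∂μ, M ω e.1.1 e.1.2 = 1 ∨ M ω e.1.1 e.1.2 = 0 := by
    intro e
    have hl := h.law e.1.1 e.1.2 e.2
    have hm : MeasurableSet {x : ℝ | x = 1 ∨ x = 0} :=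
      (measurableSet_singleton (1 : ℝ)).union (measurableSet_singleton 0)
    suffices hae : ∀ᵐ x ∂(μ.map fun ω => M ω e.1.1 e.1.2), x = 1 ∨ x = 0 from
      ae_of_ae_map hl.aemeasurable hae
    rw [hl.map_eq, ae_iff]
    have : MeasurableSet {x : ℝ | ¬ (x = 1 ∨ x = 0)} := hm.compl
    exact bernoulliMeasure_apply_of_notMem_of_notMem _ this (by simp) (by simp)
  filter_upwards [ae_all_iff.2 h1] with ω hω
  refine ⟨fun e => decide (M ω e.1.1 e.1.2 = 1), ?_⟩
  rw [eq_graphMatrix_iff (h.symm ω) (h.hollow ω)]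
  intro e
  rcases hω e with h' | h' <;> simp [h']

-- Almost every outcome lies in one of finitely many atoms `A = graphMatrix a`, `X = graphMatrix x`,
-- whose masses factor by independence. Covering by atoms requires no measurability of `S`.
open Classical in
theorem measureReal_le_bernMean [IsProbabilityMeasure μ] {Λ Γ : Fin n → Fin n → I}
    {A X : Ω → Matrix (Fin n) (Fin n) ℝ} (hA : IsBernoulliGraph μ Λ A)
    (hX : IsBernoulliGraph μ Γ X) (hAX : IndepFun A X μ) (S : Set Ω)
    (p : (VertexPair n → Bool) → (VertexPair n → Bool) → Prop)
    (hp : ∀ ω ∈ S, ∀ a x, A ω = graphMatrix a → X ω = graphMatrix x → p a x) :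
    μ.real S ≤ bernMean (fun e : VertexPair n => (Λ e.1.1 e.1.2 : ℝ)) fun a =>
      bernMean (fun e : VertexPair n => (Γ e.1.1 e.1.2 : ℝ)) fun x => if p a x then 1 else 0 := by
  have hsing : ∀ a : VertexPair n → Bool, MeasurableSet {M : Matrix (Fin n) (Fin n) ℝ |
      M = graphMatrix a} := by
    intro a
    have : {M : Matrix (Fin n) (Fin n) ℝ | M = graphMatrix a} =
        ({(graphMatrix a : Fin n → Fin n → ℝ)} : Set (Fin n → Fin n → ℝ)) := rfl
    rw [this]
    exact measurableSet_singleton (α := Fin n → Fin n → ℝ) _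
  have hprod : ∀ a x, μ.real {ω | A ω = graphMatrix a ∧ X ω = graphMatrix x} =
      bernWeight (fun e : VertexPair n => (Λ e.1.1 e.1.2 : ℝ)) a *
        bernWeight (fun e : VertexPair n => (Γ e.1.1 e.1.2 : ℝ)) x := by
    intro a x
    rw [← hA.measureReal_eq_graphMatrix, ← hX.measureReal_eq_graphMatrix, measureReal_def,
      measureReal_def, measureReal_def, ← ENNReal.toReal_mul]
    exact congrArg _ (hAX.measure_inter_preimage_eq_mul _ _ (hsing a) (hsing x))
  have hsub : μ.real S ≤ μ.real (⋃ z ∈ (Finset.univ.filter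
      fun z : (VertexPair n → Bool) × (VertexPair n → Bool) => p z.1 z.2),
      {ω | A ω = graphMatrix z.1 ∧ X ω = graphMatrix z.2}) := by
    refine ENNReal.toReal_mono (measure_ne_top _ _) (measure_mono_ae ?_)
    filter_upwards [hA.ae_exists, hX.ae_exists] with ω ⟨a, ha⟩ ⟨x, hx⟩ hω
    exact Set.mem_iUnion₂.2 ⟨(a, x), by simpa using hp ω hω a x ha hx, ha, hx⟩
  refine hsub.trans ((measureReal_biUnion_finset_le _ _).trans_eq ?_)
  rw [Finset.sum_filter, Fintype.sum_prod_type]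
  simp only [bernMean, Finset.mul_sum, hprod]
  refine Finset.sum_congr rfl fun a _ => Finset.sum_congr rfl fun x _ => ?_
  split_ifs <;> simp

-- Apply the upper bound to the complement of `S`; subadditivity gives `1 ≤ μ S + μ Sᶜ` even for
-- non-measurable `S`.
open Classical in
theorem bernMean_le_measureReal [IsProbabilityMeasure μ] {Λ Γ : Fin n → Fin n → I}
    {A X : Ω → Matrix (Fin n) (Fin n) ℝ} (hA : IsBernoulliGraph μ Λ A)
    (hX : IsBernoulliGraph μ Γ X) (hAX : IndepFun A X μ) (S : Set Ω)
    (p : (VertexPair n → Bool) → (VertexPair n → Bool) → Prop)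
    (hp : ∀ ω a x, A ω = graphMatrix a → X ω = graphMatrix x → p a x → ω ∈ S) :
    (bernMean (fun e : VertexPair n => (Λ e.1.1 e.1.2 : ℝ)) fun a =>
      bernMean (fun e : VertexPair n => (Γ e.1.1 e.1.2 : ℝ)) fun x => if p a x then 1 else 0) ≤
      μ.real S := by
  have h1 : μ.real Sᶜ ≤ bernMean (fun e : VertexPair n => (Λ e.1.1 e.1.2 : ℝ)) fun a =>
      bernMean (fun e : VertexPair n => (Γ e.1.1 e.1.2 : ℝ)) fun x =>
        1 - if p a x then 1 else 0 := by
    refine (measureReal_le_bernMean hA hX hAX Sᶜ (fun a x => ¬ p a x)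
      (fun ω hω a x ha hx hpa => hω (hp ω a x ha hx hpa))).trans_eq ?_
    congr 1; ext a; congr 1; ext x
    by_cases h : p a x <;> simp [h]
  have h2 : (1 : ℝ) ≤ μ.real S + μ.real Sᶜ := by
    rw [← probReal_univ (μ := μ), ← Set.union_compl_self S]
    exact measureReal_union_le _ _
  simp only [bernMean_sub, bernMean_const] at h1
  linarith

end Transfer

/-! ### Ring distance and edge probabilities -/

section Ring

variable {n : ℕ}

theorem ringDist_self (i : Fin n) : ringDist i i = 0 := by
  simp [ringDist]

theorem ringDist_comm (i j : Fin n) : ringDist i j = ringDist j i := by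
  have : ((i : ℤ) - (j : ℤ)).natAbs = ((j : ℤ) - (i : ℤ)).natAbs := by omega
  simp [ringDist, this]

/-- Such a vertex is `i ± t` or `i ± (n - t)`. -/
theorem card_ringDist_eq_le (i : Fin n) (t : ℕ) :
    (Finset.univ.filter fun j => ringDist i j = t).card ≤ 4 := by
  have h : (Finset.univ.filter fun j => ringDist i j = t).card ≤
      ({(i : ℕ) + t, (i : ℕ) - t, (i : ℕ) + (n - t), (i : ℕ) - (n - t)} : Finset ℕ).card := by
    refine Finset.card_le_card_of_injOn (fun j : Fin n => (j : ℕ)) ?_ Fin.val_injective.injOn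
    intro j hj
    replace hj : ringDist i j = t := (Finset.mem_filter.1 (Finset.mem_coe.1 hj)).2
    unfold ringDist at hj
    have := i.2
    have := j.2
    simp only [Finset.coe_insert, Finset.coe_singleton, Set.mem_insert_iff, Set.mem_singleton_iff]
    omega
  exact h.trans Finset.card_le_four

theorem card_ringDist_le_le (i : Fin n) (d : ℕ) :
    (Finset.univ.filter fun j => ringDist i j ≤ d).card ≤ 4 * (d + 1) := by
  have h : (Finset.univ.filter fun j => ringDist i j ≤ d) ⊆
      (Finset.range (d + 1)).biUnion fun t => Finset.univ.filter fun j => ringDist i j = t := by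
    intro j hj
    simp only [Finset.mem_filter, Finset.mem_univ, true_and] at hj
    simp only [Finset.mem_biUnion, Finset.mem_range, Finset.mem_filter, Finset.mem_univ, true_and]
    exact ⟨_, by omega, rfl⟩
  refine (Finset.card_le_card h).trans ((Finset.card_biUnion_le_card_mul _ _ 4
    fun t _ => card_ringDist_eq_le i t).trans_eq ?_)
  rw [Finset.card_range, mul_comm]

/-- The edge probabilities of the Newman-Watts graph. -/
def nwProb (n d : ℕ) (β : ℝ) (e : VertexPair n) : ℝ :=
  if ringDist e.1.1 e.1.2 ≤ d then 1 else β

theorem nwProb_nonneg {d : ℕ} {β : ℝ} (h : 0 ≤ β) (e : VertexPair n) : 0 ≤ nwProb n d β e := by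
  unfold nwProb; split_ifs <;> linarith

theorem nwProb_le_one {d : ℕ} {β : ℝ} (h : β ≤ 1) (e : VertexPair n) : nwProb n d β e ≤ 1 := by
  unfold nwProb; split_ifs <;> linarith

theorem nwProb_eq (d : ℕ) (β : I) :
    (fun e : VertexPair n => ((if ringDist e.1.1 e.1.2 ≤ d then (1 : I) else β : I) : ℝ)) =
      nwProb n d β := by
  ext e; unfold nwProb; split_ifs <;> simp

end Ring

/-! ### Many pairs are displaced by a permutation -/

section Displaced

variable {n : ℕ}

/-- Take `U` of maximal size. A moved vertex outside `U` that is neither an image nor a preimage of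
a point of `U` could be added, so `U`, `s U` and `s⁻¹ U` cover the support. -/
theorem exists_displaced_set (s : Equiv.Perm (Fin n)) :
    ∃ U : Finset (Fin n), (∀ u ∈ U, s u ∉ U) ∧ s.support.card ≤ 3 * U.card := by
  obtain ⟨U, hU, hmax⟩ := Finset.exists_max_image
    (Finset.univ.filter fun U : Finset (Fin n) => ∀ u ∈ U, s u ∉ U) Finset.card ⟨∅, by simp⟩
  simp only [Finset.mem_filter, Finset.mem_univ, true_and] at hU hmax
  refine ⟨U, hU, ?_⟩
  have hsub : s.support ⊆ U ∪ (U.image s ∪ U.image (s⁻¹ : Equiv.Perm (Fin n))) := by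
    intro v hv
    by_contra hc
    simp only [Finset.mem_union, Finset.mem_image, not_or, not_exists, not_and] at hc
    obtain ⟨h1, h2, h3⟩ := hc
    have := hmax (insert v U) (by
      intro u hu
      rw [Finset.mem_insert] at hu ⊢
      rintro (h | h)
      · rcases hu with rfl | hu
        · exact Equiv.Perm.mem_support.1 hv h
        · exact h2 u hu h
      · rcases hu with rfl | hu
        · exact h3 _ h (by simp)
        · exact hU u hu h)
    rw [Finset.card_insert_of_notMem h1] at this
    omega
  have h1 := Finset.card_le_card hsub
  have h2 := Finset.card_union_le U (U.image s ∪ U.image (s⁻¹ : Equiv.Perm (Fin n)))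
  have h3 := Finset.card_union_le (U.image s) (U.image (s⁻¹ : Equiv.Perm (Fin n)))
  have h4 := Finset.card_image_le (s := U) (f := s)
  have h5 := Finset.card_image_le (s := U) (f := (s⁻¹ : Equiv.Perm (Fin n)))
  omega

theorem exists_displaced_pairs (s : Equiv.Perm (Fin n)) {d : ℕ} (hd : 16 * (d + 1) ≤ n) :
    ∃ M : Finset (VertexPair n), (∀ e ∈ M, d < ringDist e.1.1 e.1.2) ∧
      (∀ e ∈ M, pairMap s e ∉ M) ∧ s.support.card * n ≤ 24 * M.card := by
  obtain ⟨U, hU, hcard⟩ := exists_displaced_set s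
  have hU' : ∀ u ∈ U, s⁻¹ u ∉ U := fun u hu h => hU _ h (by simpa using hu)
  -- Pairs that meet `U`, avoid `s U`, and are not lattice edges. The image of such a pair meets `s
  -- U`, so it leaves `M`.
  set M : Finset (VertexPair n) := Finset.univ.filter fun e =>
    (e.1.1 ∈ U ∨ e.1.2 ∈ U) ∧ s⁻¹ e.1.1 ∉ U ∧ s⁻¹ e.1.2 ∉ U ∧ d < ringDist e.1.1 e.1.2 with hM
  refine ⟨M, fun e he => ?_, fun e he h => ?_, ?_⟩
  · simp only [hM, Finset.mem_filter] at he
    exact he.2.2.2.2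
  · simp only [hM, Finset.mem_filter, Finset.mem_univ, true_and, pairMap] at he h
    have hinv : ∀ v, s⁻¹ (s v) = v := s.symm_apply_apply
    rcases mkPair_cases (s e.1.1) (s e.1.2) (s.injective.ne e.2.ne) with ⟨h1, h2⟩ | ⟨h1, h2⟩ <;>
    · simp only [h1, h2, hinv] at h
      tauto
  · have hhalf : 2 * U.card ≤ n := by
      have hdis : Disjoint U (U.image s) := by
        rw [Finset.disjoint_left]
        intro u hu h
        obtain ⟨v, hv, rfl⟩ := Finset.mem_image.1 h
        exact hU v hv hu
      have h1 := Finset.card_le_univ (U ∪ U.image s)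
      rw [Finset.card_union_of_disjoint hdis, Finset.card_image_of_injective _ s.injective,
        Fintype.card_fin] at h1
      omega
    -- Admissible partners of `u`: at most `n/2` vertices are lost to `s U` and at most `4(d + 1) ≤
    -- n/4` to the ball around `u`, so at least `n/4` remain.
    set N : Fin n → Finset (Fin n) := fun u =>
      Finset.univ.filter fun w => s⁻¹ w ∉ U ∧ d < ringDist u w with hN
    have hNcard : ∀ u, n ≤ (N u).card + U.card + 4 * (d + 1) := by
      intro u
      have hcov : (Finset.univ : Finset (Fin n)) ⊆
          (N u ∪ U.image s) ∪ Finset.univ.filter fun j => ringDist u j ≤ d := by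
        intro w _
        by_cases h1 : s⁻¹ w ∈ U
        · exact Finset.mem_union_left _ (Finset.mem_union_right _
            (Finset.mem_image.2 ⟨_, h1, by simp⟩))
        · by_cases h2 : ringDist u w ≤ d
          · exact Finset.mem_union_right _ (by simpa using h2)
          · refine Finset.mem_union_left _ (Finset.mem_union_left _ ?_)
            simp only [hN, Finset.mem_filter, Finset.mem_univ, true_and]
            exact ⟨h1, not_le.1 h2⟩
      have h1 := Finset.card_le_card hcov
      rw [Finset.card_univ, Fintype.card_fin] at h1
      have h2 := Finset.card_union_le (N u ∪ U.image s)
        (Finset.univ.filter fun j => ringDist u j ≤ d)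
      have h3 := Finset.card_union_le (N u) (U.image s)
      have h4 := Finset.card_image_le (s := U) (f := s)
      have h5 := card_ringDist_le_le u d
      omega
    -- Each pair comes from at most two choices of `(u, w)`; the Boolean records which endpoint is
    -- `u`. Hence `|M| ≥ |U| n / 8`, and the bound on the support gives the constant 24.
    have hsurj : (U.sigma N).card ≤ (M ×ˢ (Finset.univ : Finset Bool)).card := by
      refine Finset.card_le_card_of_surjOn
        (fun z => if z.2 then ⟨z.1.1.1, z.1.1.2⟩ else ⟨z.1.1.2, z.1.1.1⟩) ?_
      rintro ⟨u, w⟩ huw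
      simp only [Finset.coe_sigma, hN, Set.mem_sigma_iff, Finset.mem_coe, Finset.mem_filter,
        Finset.mem_univ, true_and] at huw
      obtain ⟨hu, hw, hr⟩ := huw
      have hne : u ≠ w := by
        rintro rfl
        simp [ringDist_self] at hr
      rcases lt_or_gt_of_ne hne with h | h
      · refine ⟨(⟨(u, w), h⟩, true), ?_, by simp⟩
        simp only [hM, Finset.coe_product, Set.mem_prod, Finset.mem_coe, Finset.mem_filter,
          Finset.mem_univ, true_and, and_true]
        exact ⟨Or.inl hu, hU' u hu, hw, hr⟩
      · refine ⟨(⟨(w, u), h⟩, false), ?_, by simp⟩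
        simp only [hM, Finset.coe_product, Set.mem_prod, Finset.mem_coe, Finset.mem_filter,
          Finset.mem_univ, true_and, and_true]
        exact ⟨Or.inr hu, hw, hU' u hu, by rwa [ringDist_comm]⟩
    rw [Finset.card_sigma, Finset.card_product, Finset.card_univ, Fintype.card_bool] at hsurj
    have hlow : U.card * n ≤ 4 * ∑ u ∈ U, (N u).card := by
      rw [Finset.mul_sum, ← smul_eq_mul, ← Finset.sum_const]
      refine Finset.sum_le_sum fun u _ => ?_
      have := hNcard u
      omega
    nlinarith

end Displaced

/-! ### Summing over permutations by support size -/

section PermSum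

/-- The weight is a product over vertices, so enlarging the sum from permutations to all self-maps
of the vertex set makes it factor. -/
theorem sum_pow_card_support_le (n : ℕ) {x : ℝ} (hx : 0 ≤ x) :
    ∑ s ∈ (Finset.univ : Finset (Equiv.Perm (Fin n))).erase 1, x ^ s.support.card ≤
      (1 + n * x) ^ n - 1 := by
  have h1 : ∑ s : Equiv.Perm (Fin n), x ^ s.support.card ≤ (1 + n * x) ^ n := by
    have e : ∀ s : Equiv.Perm (Fin n), x ^ s.support.card = ∏ i, if s i = i then 1 else x := by
      intro s
      rw [Finset.prod_ite, Finset.prod_const_one, one_mul, Finset.prod_const]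
      rfl
    calc ∑ s : Equiv.Perm (Fin n), x ^ s.support.card
        = ∑ s : Equiv.Perm (Fin n), ∏ i, if s i = i then 1 else x :=
          Finset.sum_congr rfl fun s _ => e s
      _ = ∑ f ∈ (Finset.univ : Finset (Equiv.Perm (Fin n))).map ⟨_, DFunLike.coe_injective⟩,
            ∏ i, if f i = i then 1 else x := by
          rw [Finset.sum_map]; rfl
      _ ≤ ∑ f : Fin n → Fin n, ∏ i, if f i = i then 1 else x := by
          refine Finset.sum_le_sum_of_subset_of_nonneg (Finset.subset_univ _) fun f _ _ => ?_
          exact Finset.prod_nonneg fun i _ => by split_ifs <;> linarith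
      _ = ∏ i : Fin n, ∑ j : Fin n, if j = i then 1 else x := by
          rw [Finset.prod_univ_sum, Fintype.piFinset_univ]
      _ ≤ ∏ _i : Fin n, (1 + n * x) := by
          refine Finset.prod_le_prod (fun i _ => Finset.sum_nonneg fun j _ => by
            split_ifs <;> linarith) fun i _ => ?_
          calc ∑ j : Fin n, (if j = i then 1 else x) ≤ ∑ j : Fin n, ((if j = i then 1 else 0) + x) :=
                Finset.sum_le_sum fun j _ => by split_ifs <;> linarith
            _ = _ := by simp [Finset.sum_add_distrib]
      _ = _ := by simp
  rw [← Finset.add_sum_erase _ _ (Finset.mem_univ (1 : Equiv.Perm (Fin n)))] at h1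
  simp only [Equiv.Perm.support_one, Finset.card_empty, pow_zero] at h1
  linarith

theorem one_add_pow_sub_one_le {n : ℕ} (hn : 1 ≤ n) {x : ℝ} (hx : 0 ≤ x)
    (hxn : x * (n : ℝ) ^ 4 ≤ 1) : (1 + n * x) ^ n - 1 ≤ 2 / (n : ℝ) ^ 2 := by
  have hn' : (1 : ℝ) ≤ n := by exact_mod_cast hn
  have hy : (n : ℝ) * (n * x) ≤ 1 / (n : ℝ) ^ 2 := by
    rw [le_div_iff₀ (by positivity)]
    nlinarith
  have hy1 : (n : ℝ) * (n * x) ≤ 1 := hy.trans (by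
    rw [div_le_one (by positivity)]; nlinarith)
  have hy0 : 0 ≤ (n : ℝ) * (n * x) := by positivity
  have h1 : (1 + n * x) ^ n ≤ Real.exp (n * (n * x)) := by
    rw [Real.exp_nat_mul]
    exact pow_le_pow_left₀ (by positivity) (by linarith [Real.add_one_le_exp (n * x)]) n
  have h2 : Real.exp (n * (n * x)) ≤ 1 + 2 * (n * (n * x)) := by
    have := Real.abs_exp_sub_one_sub_id_le (x := (n : ℝ) * (n * x)) (by rwa [abs_of_nonneg hy0])
    have := (abs_le.1 this).2
    nlinarith
  have : 2 / (n : ℝ) ^ 2 = 2 * (1 / (n : ℝ) ^ 2) := by ring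
  linarith

end PermSum

/-! ### Upper bound on the failure probability -/

section Consistency

theorem bernMean_matchCost_le {n d : ℕ} {β δ : ℝ} (hβ0 : 0 ≤ β) (hβ : β ≤ 1 / 2) (hδ0 : 0 ≤ δ)
    (hδ : δ ≤ 1 / 2) (hd : 16 * (d + 1) ≤ n) (s : Equiv.Perm (Fin n)) :
    bernMean (nwProb n d β) (fun a => bernMean (fun _ => 1 / 2 - δ) fun x =>
      if ∑ e ∈ disagree s a, (1 - 2 * (if x e then (1 : ℝ) else 0)) ≤ 0 then 1 else 0) ≤
      Real.exp (-(δ ^ 2 * β * n / 24)) ^ s.support.card := by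
  obtain ⟨M, hM1, hM2, hM3⟩ := exists_displaced_pairs s hd
  have hβ1 : β ≤ 1 := by linarith
  have hρ0 : 0 ≤ 1 - δ ^ 2 := by nlinarith
  have hρ1 : 1 - δ ^ 2 ≤ 1 := by nlinarith [sq_nonneg δ]
  -- The Chernoff factor carries one `1 - δ²` per disagreement. Dropping those outside `M` only
  -- increases the bound and makes the one-at-a-time resampling applicable.
  calc _ ≤ bernMean (nwProb n d β) (fun a => ∏ e ∈ M, if a (pairMap s e) ≠ a e
          then (1 - δ ^ 2) else 1) := by
        refine bernMean_mono (nwProb_nonneg hβ0) (nwProb_le_one hβ1) fun a => ?_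
        refine (bernMean_majority_le hδ0 hδ _).trans ?_
        rw [← Finset.prod_filter, Finset.prod_const]
        refine pow_le_pow_of_le_one hρ0 hρ1 (Finset.card_le_card ?_)
        exact Finset.filter_subset_filter _ (Finset.subset_univ M)
    _ ≤ (1 - (1 - (1 - δ ^ 2)) * β) ^ M.card := by
        refine bernMean_disagree_le (nwProb_nonneg hβ0) (nwProb_le_one hβ1) hβ hρ0 hρ1 _ M
          (fun e he => ?_) hM2
        rw [nwProb, if_neg (not_le.2 (hM1 e he))]
    _ ≤ Real.exp (-(δ ^ 2 * β)) ^ M.card := by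
        refine pow_le_pow_left₀ (by nlinarith [sq_nonneg δ]) ?_ _
        have := Real.add_one_le_exp (-(δ ^ 2 * β))
        linarith
    _ ≤ _ := by
        rw [← Real.exp_nat_mul, ← Real.exp_nat_mul]
        refine Real.exp_le_exp.2 ?_
        have h1 : (s.support.card : ℝ) * n ≤ 24 * M.card := by exact_mod_cast hM3
        have h2 : 0 ≤ δ ^ 2 * β := by positivity
        nlinarith

theorem measureReal_exists_matchCost_le {Ω : Type*} [MeasurableSpace Ω] {μ : Measure Ω}
    [IsProbabilityMeasure μ] {n d : ℕ} {β p : I} {A X : Ω → Matrix (Fin n) (Fin n) ℝ}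
    (hA : IsNewmanWatts μ n d β A) (hX : IsChannelNoise μ n p X) (hAX : IndepFun A X μ)
    (hβ : (β : ℝ) ≤ 1 / 2) (hp : (p : ℝ) ≤ 1 / 2) (hd : 16 * (d + 1) ≤ n)
    (hlog : 96 * Real.log n ≤ (1 / 2 - (p : ℝ)) ^ 2 * β * n) :
    μ.real {ω | ∃ s : Equiv.Perm (Fin n), s ≠ 1 ∧
      matchCost (A ω) (corrupt (A ω) (X ω) 1) s ≤ matchCost (A ω) (corrupt (A ω) (X ω) 1) 1} ≤
      2 / (n : ℝ) ^ 2 := by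
  set δ := 1 / 2 - (p : ℝ) with hδ
  have hp0 := p.2.1
  have hn : 1 ≤ n := by omega
  have hn0 : (0 : ℝ) < n := by exact_mod_cast hn
  set x := Real.exp (-(δ ^ 2 * β * n / 24)) with hx
  -- The constant `96 = 4 · 24` gives `x ≤ n⁻⁴`, small enough for a summable union bound.
  have hxn : x * (n : ℝ) ^ 4 ≤ 1 := by
    have h4 : (n : ℝ) ^ 4 = Real.exp ((4 : ℕ) * Real.log n) := by
      rw [Real.exp_nat_mul, Real.exp_log hn0]
    rw [h4, hx, ← Real.exp_add]
    refine Real.exp_le_one_iff.2 ?_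
    push_cast
    linarith
  refine le_trans ?_ (one_add_pow_sub_one_le hn (Real.exp_pos _).le hxn)
  refine le_trans ?_ (sum_pow_card_support_le n (Real.exp_pos _).le)
  have hU : {ω | ∃ s : Equiv.Perm (Fin n), s ≠ 1 ∧
      matchCost (A ω) (corrupt (A ω) (X ω) 1) s ≤ matchCost (A ω) (corrupt (A ω) (X ω) 1) 1} =
      ⋃ s ∈ (Finset.univ : Finset (Equiv.Perm (Fin n))).erase 1, {ω |
        matchCost (A ω) (corrupt (A ω) (X ω) 1) s ≤ matchCost (A ω) (corrupt (A ω) (X ω) 1) 1} := by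
    ext ω; simp
  rw [hU]
  refine (measureReal_biUnion_finset_le _ _).trans (Finset.sum_le_sum fun s _ => ?_)
  have h := measureReal_le_bernMean hA hX hAX {ω |
        matchCost (A ω) (corrupt (A ω) (X ω) 1) s ≤ matchCost (A ω) (corrupt (A ω) (X ω) 1) 1}
    (fun a x => ∑ e ∈ disagree s a, (1 - 2 * (if x e then (1 : ℝ) else 0)) ≤ 0) (by
      intro ω hω a x ha hx
      rw [Set.mem_ofPred_eq, ha, hx] at hω
      have := matchCost_sub a x s
      linarith)
  rw [nwProb_eq] at h
  have hpδ : (fun _ : VertexPair n => (p : ℝ)) = fun _ => 1 / 2 - δ := by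
    ext; rw [hδ]; ring
  rw [hpδ] at h
  refine h.trans (le_trans (le_of_eq ?_) (bernMean_matchCost_le β.2.1 hβ (by linarith) (by linarith) hd s))
  congr!

end Consistency

/-! ### Ties created by transpositions -/

section Transposition

variable {n : ℕ}

theorem pairMap_mkPair (s : Equiv.Perm (Fin n)) (i j : Fin n) (h : i ≠ j) :
    pairMap s (mkPair i j h) = mkPair (s i) (s j) (s.injective.ne h) := by
  by_cases h' : i < j
  · simp [pairMap, mkPair, h']
  · rw [mkPair_comm (s i)]
    simp [pairMap, mkPair, h']

theorem pairMap_swap_swap (u v : Fin n) (e : VertexPair n) :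
    pairMap (Equiv.swap u v) (pairMap (Equiv.swap u v) e) = e := by
  rw [pairMap.eq_def _ e, pairMap_mkPair]
  simp only [Equiv.swap_apply_self]
  exact mkPair_self e

/-- The transposition acts on its disagreement pairs as an involution, and a fixed pair cannot
disagree with itself. Evenness is what makes an exact tie possible. -/
theorem even_card_disagree_swap (u v : Fin n) (a : VertexPair n → Bool) :
    Even (disagree (Equiv.swap u v) a).card := by
  rw [← ZMod.natCast_eq_zero_iff_even, Finset.cast_card]
  refine Finset.sum_involution (fun e _ => pairMap (Equiv.swap u v) e) (fun _ _ => by decide)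
    (fun e he _ h => ?_) (fun e he => ?_) (fun e _ => pairMap_swap_swap u v e)
  · simp only [disagree, Finset.mem_filter] at he
    exact he.2 (by rw [h])
  · simp only [disagree, Finset.mem_filter, Finset.mem_univ, true_and] at he ⊢
    rw [pairMap_swap_swap]
    exact he.symm

/-- The pairs that contain `u` or `v`. -/
def touching (u v : Fin n) : Finset (VertexPair n) :=
  Finset.univ.filter fun e => (e.1.1 = u ∨ e.1.1 = v) ∨ (e.1.2 = u ∨ e.1.2 = v)

theorem disagree_swap_subset (u v : Fin n) (a : VertexPair n → Bool) :
    disagree (Equiv.swap u v) a ⊆ touching u v := by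
  intro e he
  simp only [disagree, touching, Finset.mem_filter, Finset.mem_univ, true_and] at he ⊢
  by_contra hc
  push Not at hc
  obtain ⟨⟨h1, h2⟩, h3, h4⟩ := hc
  refine he ?_
  have : pairMap (Equiv.swap u v) e = e := by
    unfold pairMap
    simp only [Equiv.swap_apply_of_ne_of_ne h1 h2, Equiv.swap_apply_of_ne_of_ne h3 h4]
    exact mkPair_self e
  rw [this]

theorem card_touching_le (u v : Fin n) : (touching u v).card ≤ 4 * n := by
  have h : (touching u v).card ≤
      ((({u, v} : Finset (Fin n)) ×ˢ Finset.univ) ∪ (Finset.univ ×ˢ {u, v})).card := by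
    refine Finset.card_le_card_of_injOn (fun e => e.1) (fun e he => ?_)
      Subtype.val_injective.injOn
    have he' := (Finset.mem_filter.1 (Finset.mem_coe.1 he)).2
    rw [Finset.mem_coe, Finset.mem_union, Finset.mem_product, Finset.mem_product]
    simpa using he'
  refine h.trans ((Finset.card_union_le _ _).trans ?_)
  rw [Finset.card_product, Finset.card_product, Finset.card_univ, Fintype.card_fin]
  have := Finset.card_le_two (a := u) (b := v)
  nlinarith

theorem card_touching_inter_le {u v u' v' : Fin n} (h1 : u ≠ u') (h2 : u ≠ v') (h3 : v ≠ u')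
    (h4 : v ≠ v') : (touching u v ∩ touching u' v').card ≤ 8 := by
  have h : (touching u v ∩ touching u' v').card ≤
      ((({u, v} : Finset (Fin n)) ×ˢ {u', v'}) ∪ (({u', v'} : Finset (Fin n)) ×ˢ {u, v})).card := by
    refine Finset.card_le_card_of_injOn (fun e => e.1) (fun e he => ?_)
      Subtype.val_injective.injOn
    obtain ⟨hx, hy⟩ := Finset.mem_inter.1 (Finset.mem_coe.1 he)
    have hx' := (Finset.mem_filter.1 hx).2
    have hy' := (Finset.mem_filter.1 hy).2
    simp only [Finset.coe_union, Finset.coe_product, Finset.coe_insert, Finset.coe_singleton,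
      Set.mem_union, Set.mem_prod, Set.mem_insert_iff, Set.mem_singleton_iff]
    grind
  refine h.trans ((Finset.card_union_le _ _).trans ?_)
  rw [Finset.card_product, Finset.card_product]
  have := Finset.card_le_two (a := u) (b := v)
  have := Finset.card_le_two (a := u') (b := v')
  nlinarith

theorem ringDist_succ {u v : Fin n} (h : (v : ℕ) = u + 1) (w : Fin n) :
    ringDist u w ≤ ringDist v w + 1 ∧ ringDist v w ≤ ringDist u w + 1 := by
  have := u.2
  have := v.2
  have := w.2
  unfold ringDist
  omega

theorem nwProb_mkPair (d : ℕ) (β : ℝ) (i j : Fin n) (h : i ≠ j) :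
    nwProb n d β (mkPair i j h) = if ringDist i j ≤ d then 1 else β := by
  unfold nwProb mkPair
  split_ifs <;> simp_all [ringDist_comm]

/-- Exchanging consecutive vertices changes distances to a third vertex by at most 1. So a pair can
enter or leave the lattice only if it joins `u` or `v` to a vertex at distance `d` or `d + 1`: at
most 16 ordered choices, and 32 with both orders. -/
theorem card_nwProb_swap_ne_le {u v : Fin n} (h : (v : ℕ) = u + 1) (d : ℕ) (β : ℝ) :
    (Finset.univ.filter fun e : VertexPair n =>
      nwProb n d β (pairMap (Equiv.swap u v) e) ≠ nwProb n d β e).card ≤ 32 := by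
  set B : Finset (Fin n × Fin n) := ({u, v} : Finset (Fin n)).biUnion fun z =>
    ((Finset.univ.filter fun j => ringDist z j = d) ∪
      (Finset.univ.filter fun j => ringDist z j = d + 1)).image (Prod.mk z) with hB
  have hBcard : B.card ≤ 16 := by
    refine (Finset.card_biUnion_le_card_mul _ _ 8 fun z _ => ?_).trans ?_
    · refine Finset.card_image_le.trans ((Finset.card_union_le _ _).trans ?_)
      have := card_ringDist_eq_le z d
      have := card_ringDist_eq_le z (d + 1)
      omega
    · have := Finset.card_le_two (a := u) (b := v)
      omega
  have hmem : ∀ z w, (z = u ∨ z = v) → (ringDist z w = d ∨ ringDist z w = d + 1) → (z, w) ∈ B := by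
    intro z w hz hw
    simp only [hB, Finset.mem_biUnion, Finset.mem_image]
    exact ⟨z, by simpa using hz, w, by simpa using hw, rfl⟩
  have hcard : (Finset.univ.filter fun e : VertexPair n =>
      nwProb n d β (pairMap (Equiv.swap u v) e) ≠ nwProb n d β e).card ≤
      (B ∪ B.image Prod.swap).card := by
    refine Finset.card_le_card_of_injOn (fun e => e.1) (fun e he => ?_)
      Subtype.val_injective.injOn
    replace he := (Finset.mem_filter.1 (Finset.mem_coe.1 he)).2
    obtain ⟨⟨i, j⟩, hij⟩ := e
    simp only [pairMap, nwProb_mkPair] at he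
    have hst : ¬ (ringDist (Equiv.swap u v i) (Equiv.swap u v j) ≤ d ↔ ringDist i j ≤ d) := by
      intro hst
      exact he (by simp only [nwProb]; exact if_congr hst rfl rfl)
    have hne : i ≠ j := hij.ne
    rw [Finset.mem_coe, Finset.mem_union]
    have hsw : (j, i) ∈ B → (i, j) ∈ B.image Prod.swap := fun h =>
      Finset.mem_image.2 ⟨_, h, rfl⟩
    by_cases hi : i = u ∨ i = v
    · by_cases hj : j = u ∨ j = v
      · exfalso
        refine hst ?_
        rcases hi with rfl | rfl <;> rcases hj with rfl | rfl <;>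
          simp_all [ringDist_comm]
      · push Not at hj
        rw [Equiv.swap_apply_of_ne_of_ne hj.1 hj.2] at hst
        have hr := ringDist_succ h j
        left
        refine hmem i j hi ?_
        rcases hi with rfl | rfl
        · rw [Equiv.swap_apply_left] at hst; omega
        · rw [Equiv.swap_apply_right] at hst; omega
    · push Not at hi
      rw [Equiv.swap_apply_of_ne_of_ne hi.1 hi.2] at hst
      by_cases hj : j = u ∨ j = v
      · have hr := ringDist_succ h i
        right
        refine hsw (hmem j i hj ?_)
        rw [ringDist_comm i, ringDist_comm i] at hst
        rcases hj with rfl | rfl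
        · rw [Equiv.swap_apply_left] at hst; omega
        · rw [Equiv.swap_apply_right] at hst; omega
      · push Not at hj
        rw [Equiv.swap_apply_of_ne_of_ne hj.1 hj.2] at hst
        exact absurd Iff.rfl hst
  refine hcard.trans ((Finset.card_union_le _ _).trans ?_)
  have := Finset.card_image_le (s := B) (f := Prod.swap)
  omega

/-- At most 32 pairs cost 1 each, and the at most `4n` touching pairs cost `2β` each. The lattice
cancels almost completely, so the bound does not depend on `d`. -/
theorem bernMean_card_disagree_le {u v : Fin n} (h : (v : ℕ) = u + 1) (d : ℕ) {β : ℝ}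
    (h0 : 0 ≤ β) (h1 : β ≤ 1) :
    bernMean (nwProb n d β) (fun a => ((disagree (Equiv.swap u v) a).card : ℝ)) ≤
      32 + 8 * β * n := by
  have e : (fun a => ((disagree (Equiv.swap u v) a).card : ℝ)) = fun a =>
      ∑ e ∈ touching u v, if a (pairMap (Equiv.swap u v) e) ≠ a e then (1 : ℝ) else 0 := by
    ext a
    rw [Finset.sum_boole]
    congr 2
    ext e
    have := @disagree_swap_subset n u v a e
    simp only [disagree, Finset.mem_filter, Finset.mem_univ, true_and] at this ⊢
    tauto
  rw [e, bernMean_sum]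
  have hb : ∀ e ∈ touching u v, bernMean (nwProb n d β)
      (fun a => if a (pairMap (Equiv.swap u v) e) ≠ a e then (1 : ℝ) else 0) ≤
      (if nwProb n d β (pairMap (Equiv.swap u v) e) ≠ nwProb n d β e then 1 else 0) + 2 * β := by
    intro e _
    refine bernMean_ne_le (nwProb_nonneg h0) (nwProb_le_one h1) _ _ h0 fun _ => ?_
    unfold nwProb
    split_ifs <;> simp
  refine (Finset.sum_le_sum hb).trans ?_
  rw [Finset.sum_add_distrib, Finset.sum_boole, Finset.sum_const, nsmul_eq_mul]
  have c1 : (((touching u v).filter fun e : VertexPair n =>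
      nwProb n d β (pairMap (Equiv.swap u v) e) ≠ nwProb n d β e).card : ℝ) ≤ 32 := by
    exact_mod_cast (Finset.card_le_card (Finset.filter_subset_filter _
      (Finset.subset_univ _))).trans (card_nwProb_swap_ne_le h d β)
  have c2 : ((touching u v).card : ℝ) ≤ 4 * n := by exact_mod_cast card_touching_le u v
  nlinarith

/-- Transpositions of consecutive vertices with disjoint supports. -/
def pairSwap (n : ℕ) (r : Fin (n / 2)) : Equiv.Perm (Fin n) :=
  Equiv.swap ⟨2 * r, by omega⟩ ⟨2 * r + 1, by omega⟩

theorem pairSwap_ne_one (r : Fin (n / 2)) : pairSwap n r ≠ 1 := by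
  intro h
  have := Equiv.swap_eq_one_iff.1 h
  simp at this

theorem even_card_disagree_pairSwap (r : Fin (n / 2)) (a : VertexPair n → Bool) :
    Even (disagree (pairSwap n r) a).card :=
  even_card_disagree_swap _ _ a

theorem bernMean_card_disagree_pairSwap_le (r : Fin (n / 2)) (d : ℕ) {β : ℝ}
    (h0 : 0 ≤ β) (h1 : β ≤ 1) :
    bernMean (nwProb n d β) (fun a => ((disagree (pairSwap n r) a).card : ℝ)) ≤
      32 + 8 * β * n :=
  bernMean_card_disagree_le rfl d h0 h1

theorem disagree_pairSwap_inter_card_le (a : VertexPair n → Bool) {r t : Fin (n / 2)}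
    (h : r ≠ t) : (disagree (pairSwap n r) a ∩ disagree (pairSwap n t) a).card ≤ 8 := by
  have h' : (r : ℕ) ≠ t := fun hc => h (Fin.ext hc)
  refine (Finset.card_le_card (Finset.inter_subset_inter (disagree_swap_subset _ _ a)
    (disagree_swap_subset _ _ a))).trans (card_touching_inter_le ?_ ?_ ?_ ?_) <;>
  · rw [Ne, Fin.mk.injEq]
    omega

/-- Half of the pairs on which the images of `a` disagree are flipped by the noise. -/
def IsBalancedFlip (s : Equiv.Perm (Fin n)) (a x : VertexPair n → Bool) : Prop :=
  ((disagree s a).filter fun e => x e = true).card = (disagree s a).card / 2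

instance (s : Equiv.Perm (Fin n)) (a x : VertexPair n → Bool) : Decidable (IsBalancedFlip s a x) :=
  inferInstanceAs (Decidable (_ = _))

/-- The signs `1 - 2x` cancel, the division by 2 being exact by evenness. -/
theorem matchCost_pairSwap_eq {a x : VertexPair n → Bool} {r : Fin (n / 2)}
    (h : IsBalancedFlip (pairSwap n r) a x) :
    matchCost (graphMatrix a) (corrupt (graphMatrix a) (graphMatrix x) 1) (pairSwap n r) =
      matchCost (graphMatrix a) (corrupt (graphMatrix a) (graphMatrix x) 1) 1 := by
  rw [← sub_eq_zero, matchCost_sub, Finset.sum_sub_distrib, ← Finset.mul_sum, Finset.sum_boole]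
  obtain ⟨D, hD⟩ := even_card_disagree_pairSwap r a
  have h' : ((disagree (pairSwap n r) a).filter fun e => x e = true).card = D := by
    rw [IsBalancedFlip] at h; omega
  rw [h', Finset.sum_const, hD]
  simp
  ring

theorem bernMean_exists_balanced_ge {δ c : ℝ} (hδ0 : 0 ≤ δ) (hδ : δ ^ 2 ≤ 1 / 16)
    (a : VertexPair n → Bool)
    (hsum : 4 * δ ^ 2 * ∑ r : Fin (n / 2), ((disagree (pairSwap n r) a).card : ℝ) ≤
      c * (n / 2 : ℕ))
    (hn : 1 ≤ n)
    (hc : 2 * Real.sqrt (2 * n) ≤ Real.exp (-c) * (n / 2 : ℕ)) :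
    1 / (1 + 4 ^ 8) ≤ bernMean (fun _ => 1 / 2 - δ)
      (fun x => if ∃ r : Fin (n / 2), IsBalancedFlip (pairSwap n r) a x then 1 else 0) := by
  have hδ4 : δ ≤ 1 / 4 := by nlinarith
  have hn' : (1 : ℝ) ≤ n := by exact_mod_cast hn
  refine bernMean_exists_ge (fun _ => by linarith) (fun _ => by linarith)
    (Finset.univ : Finset (Fin (n / 2)))
    (fun r x => if IsBalancedFlip (pairSwap n r) a x then 1 else 0) (fun r _ x => by
      split_ifs <;> simp) (by positivity) (fun r _ t _ hrt => ?_) ?_ _ (fun x => by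
      split_ifs <;> simp) (fun r _ x hx => ?_)
  · have hdep : ∀ (r : Fin (n / 2)) (x y : VertexPair n → Bool),
        (∀ e ∈ disagree (pairSwap n r) a, x e = y e) →
        (if IsBalancedFlip (pairSwap n r) a x then (1 : ℝ) else 0) =
          if IsBalancedFlip (pairSwap n r) a y then 1 else 0 := by
      intro r x y hxy
      have : (disagree (pairSwap n r) a).filter (fun e => x e = true) =
          (disagree (pairSwap n r) a).filter fun e => y e = true :=
        Finset.filter_congr fun e he => by rw [hxy e he]
      exact if_congr (by rw [IsBalancedFlip, IsBalancedFlip, this]) rfl rfl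
    have hnn : ∀ (r : Fin (n / 2)) (x : VertexPair n → Bool),
        (0 : ℝ) ≤ if IsBalancedFlip (pairSwap n r) a x then 1 else 0 := by
      intro r x; split_ifs <;> simp
    -- As `δ ≤ 1/4`, both outcomes of a noise bit have mass at least `1/4`. With at most 8 shared
    -- bits the correlation constant is `4^8`.
    have h := bernMean_mul_le (q := fun _ : VertexPair n => 1 / 2 - δ) (c := 1 / 4) (by norm_num)
      (fun _ => by linarith) (fun _ => by linarith) (disagree (pairSwap n r) a)
      (disagree (pairSwap n t) a) (hnn r) (hnn t) (hdep r) (hdep t)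
    have hpow : (1 / 4 : ℝ) ^ 8 ≤
        (1 / 4) ^ (disagree (pairSwap n r) a ∩ disagree (pairSwap n t) a).card :=
      pow_le_pow_of_le_one (by norm_num) (by norm_num) (disagree_pairSwap_inter_card_le a hrt)
    have hE : 0 ≤ bernMean (fun _ : VertexPair n => 1 / 2 - δ) (fun x =>
        (if IsBalancedFlip (pairSwap n r) a x then (1 : ℝ) else 0) *
          if IsBalancedFlip (pairSwap n t) a x then 1 else 0) :=
      bernMean_nonneg (fun _ => by linarith) (fun _ => by linarith)
        fun x => mul_nonneg (hnn r x) (hnn t x)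
    have h2 := (mul_le_mul_of_nonneg_right hpow hE).trans h
    have h3 : (4 : ℝ) ^ 8 * (1 / 4) ^ 8 = 1 := by norm_num
    calc _ = (4 : ℝ) ^ 8 * ((1 / 4) ^ 8 * _) := by rw [← mul_assoc, h3, one_mul]
      _ ≤ _ := mul_le_mul_of_nonneg_left h2 (by positivity)
  · have hlow : ∀ r : Fin (n / 2),
        Real.exp (-c) * (1 + c - 4 * δ ^ 2 * (disagree (pairSwap n r) a).card) /
          (2 * Real.sqrt (2 * n)) ≤ bernMean (fun _ => 1 / 2 - δ)
          (fun x => if IsBalancedFlip (pairSwap n r) a x then 1 else 0) := by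
      intro r
      obtain ⟨D, hD⟩ := even_card_disagree_pairSwap r a
      have hle : (disagree (pairSwap n r) a).card ≤ 4 * n :=
        (Finset.card_le_card (disagree_swap_subset _ _ a)).trans (card_touching_le _ _)
      have hDn : (D : ℝ) ≤ 2 * n := by exact_mod_cast (by omega : D ≤ 2 * n)
      have h := exp_le_bernMean_balanced (δ := δ) (K := 2 * n) (by linarith)
        (disagree (pairSwap n r) a) (D := D) (by omega) hDn (by linarith)
      have hD2 : (disagree (pairSwap n r) a).card / 2 = D := by omega
      have hexp : Real.exp (-c) * (1 + c - 4 * δ ^ 2 * (disagree (pairSwap n r) a).card) ≤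
          Real.exp (-(4 * δ ^ 2 * (disagree (pairSwap n r) a).card)) := by
        have e1 : -(4 * δ ^ 2 * ((disagree (pairSwap n r) a).card : ℝ)) =
          -c + (c - 4 * δ ^ 2 * (disagree (pairSwap n r) a).card) := by ring
        rw [e1, Real.exp_add]
        refine mul_le_mul_of_nonneg_left ?_ (Real.exp_pos _).le
        linarith [Real.add_one_le_exp (c - 4 * δ ^ 2 * ((disagree (pairSwap n r) a).card : ℝ))]
      simp only [IsBalancedFlip, hD2]
      exact (div_le_div_of_nonneg_right hexp (by positivity)).trans h
    refine le_trans ?_ (Finset.sum_le_sum fun r _ => hlow r)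
    rw [← Finset.sum_div, ← Finset.mul_sum, Finset.sum_sub_distrib, ← Finset.mul_sum,
      Finset.sum_const, Finset.card_univ, Fintype.card_fin, nsmul_eq_mul]
    rw [le_div_iff₀ (by positivity), one_mul]
    refine hc.trans (mul_le_mul_of_nonneg_left ?_ (Real.exp_pos _).le)
    linarith
  · have : IsBalancedFlip (pairSwap n r) a x := by
      by_contra h
      simp [h] at hx
    rw [if_pos ⟨r, this⟩]

theorem le_measureReal_exists_matchCost {Ω : Type*} [MeasurableSpace Ω] {μ : Measure Ω}
    [IsProbabilityMeasure μ] {d : ℕ} {β p : I} {A X : Ω → Matrix (Fin n) (Fin n) ℝ}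
    (hA : IsNewmanWatts μ n d β A) (hX : IsChannelNoise μ n p X) (hAX : IndepFun A X μ)
    (hp : (p : ℝ) ≤ 1 / 2) (hn : 2 ≤ n) (hδ : (1 / 2 - (p : ℝ)) ^ 2 ≤ 1 / 16)
    (hc : 2 * Real.sqrt (2 * n) ≤
      Real.exp (-(8 * (1 / 2 - (p : ℝ)) ^ 2 * (32 + 8 * β * n))) * (n / 2 : ℕ)) :
    1 / 2 * (1 / (1 + 4 ^ 8)) ≤ μ.real {ω | ∃ s : Equiv.Perm (Fin n), s ≠ 1 ∧
      matchCost (A ω) (corrupt (A ω) (X ω) 1) s ≤ matchCost (A ω) (corrupt (A ω) (X ω) 1) 1} := by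
  classical
  set δ := 1 / 2 - (p : ℝ) with hδd
  have hβ0 := β.2.1
  have hβ1 := β.2.2
  have hM : 1 ≤ n / 2 := by omega
  have hM' : (1 : ℝ) ≤ (n / 2 : ℕ) := by exact_mod_cast hM
  have h := bernMean_le_measureReal hA hX hAX {ω | ∃ s : Equiv.Perm (Fin n), s ≠ 1 ∧
      matchCost (A ω) (corrupt (A ω) (X ω) 1) s ≤ matchCost (A ω) (corrupt (A ω) (X ω) 1) 1}
    (fun a x => ∃ r : Fin (n / 2), IsBalancedFlip (pairSwap n r) a x) (by
      rintro ω a x ha hx ⟨r, hr⟩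
      refine ⟨pairSwap n r, pairSwap_ne_one r, ?_⟩
      rw [ha, hx]
      exact (matchCost_pairSwap_eq hr).le)
  refine le_trans ?_ h
  rw [nwProb_eq]
  have hpδ : (fun _ : VertexPair n => (p : ℝ)) = fun _ => 1 / 2 - δ := by
    ext; rw [hδd]; ring
  rw [hpδ]
  have hT : (0 : ℝ) < (n / 2 : ℕ) * (32 + 8 * β * n) := by positivity
  -- With probability at least `1/2` the graph has at most twice the expected total number of
  -- disagreements. This factor 2, times the 4 of the tie estimate, is the 8 in `hc`.
  have hmk := bernMean_markov (q := nwProb n d β) (nwProb_nonneg hβ0) (nwProb_le_one hβ1)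
    (f := fun a => ∑ r : Fin (n / 2), ((disagree (pairSwap n r) a).card : ℝ))
    (fun a => Finset.sum_nonneg fun r _ => Nat.cast_nonneg _)
    (T := (n / 2 : ℕ) * (32 + 8 * β * n)) hT (by
      rw [bernMean_sum]
      refine (Finset.sum_le_sum fun r _ => bernMean_card_disagree_pairSwap_le r d hβ0 hβ1).trans_eq ?_
      rw [Finset.sum_const, Finset.card_univ, Fintype.card_fin, nsmul_eq_mul])
  refine (mul_le_mul_of_nonneg_right hmk (by positivity)).trans ?_
  rw [← bernMean_mul_const]
  refine bernMean_mono (nwProb_nonneg hβ0) (nwProb_le_one hβ1) fun a => ?_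
  by_cases ha : ∑ r : Fin (n / 2), ((disagree (pairSwap n r) a).card : ℝ) ≤
      2 * ((n / 2 : ℕ) * (32 + 8 * β * n))
  · rw [if_pos ha, one_mul]
    refine (bernMean_exists_balanced_ge (c := 8 * δ ^ 2 * (32 + 8 * β * n)) (by linarith) hδ a ?_
      (by omega) hc).trans_eq (by congr!)
    have := mul_le_mul_of_nonneg_left ha (by positivity : 0 ≤ 4 * δ ^ 2)
    linarith
  · rw [if_neg ha, zero_mul]
    have hp0 := p.2.1
    have hp1 := p.2.2
    exact bernMean_nonneg (fun _ => by linarith) (fun _ => by linarith) fun x => by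
      by_cases hx : ∃ r : Fin (n / 2), IsBalancedFlip (pairSwap n r) a x <;> simp only [hx] <;> simp

end Transposition

/-! ### Asymptotics and conclusion -/

theorem not_mleWeaklyConsistent {Ω : Type*} [MeasurableSpace Ω] {μ : Measure Ω}
    [IsProbabilityMeasure μ] {n₀ : ℕ} {d : ℕ → ℕ} {β p : ℕ → I}
    (hp : ∀ n, n₀ ≤ n → (p n : ℝ) < 1 / 2)
    {P : (n : ℕ) → Matrix (Fin n) (Fin n) ℝ} (hP : ∀ n, n₀ ≤ n → P n ∈ permMatrices n)
    {A X B : (n : ℕ) → Ω → Matrix (Fin n) (Fin n) ℝ}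
    (hA : ∀ n, n₀ ≤ n → IsNewmanWatts μ n (d n) (β n) (A n))
    (hX : ∀ n, n₀ ≤ n → IsChannelNoise μ n (p n) (X n))
    (hAX : ∀ n, n₀ ≤ n → IndepFun (A n) (X n) μ)
    (hB : ∀ n, n₀ ≤ n → ∀ ω, B n ω = corrupt (A n ω) (X n ω) (P n))
    (h1 : (fun n : ℕ => (1 / 2 - (p n : ℝ)) ^ 2) =o[atTop]
        (fun n : ℕ => Real.sqrt (Real.log n / n)))
    (h2 : (fun n : ℕ => (β n : ℝ)) =o[atTop]
        (fun n : ℕ => Real.log n / ((1 / 2 - (p n : ℝ)) ^ 2 * n))) :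
    ¬ MLEWeaklyConsistent μ A B P := by
  intro hcons
  have hlim := hcons 1 one_pos
  have hlog : Tendsto (fun n : ℕ => Real.log n) atTop atTop :=
    Real.tendsto_log_atTop.comp tendsto_natCast_atTop_atTop
  have hlow : ∀ᶠ n : ℕ in atTop, ENNReal.ofReal (1 / 2 * (1 / (1 + 4 ^ 8))) ≤
      μ {ω | 1 ≤ edist (mleError (A n ω) (B n ω) (P n)) 0} := by
    filter_upwards [eventually_ge_atTop n₀, eventually_ge_atTop 2,
      hlog.eventually_ge_atTop 128, h1.bound (by norm_num : (0 : ℝ) < 1 / 16),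
      h2.bound (by norm_num : (0 : ℝ) < 1 / 512)] with n hn hn2 hl hb1 hb2
    have hn0 : (0 : ℝ) < n := by positivity
    set δ := 1 / 2 - (p n : ℝ) with hδ
    have hδ0 : 0 < δ := by linarith [hp n hn]
    have hβ0 := (β n).2.1
    have hδ16 : δ ^ 2 ≤ 1 / 16 := by
      rw [Real.norm_of_nonneg (sq_nonneg _), Real.norm_of_nonneg (Real.sqrt_nonneg _)] at hb1
      have hs : Real.sqrt (Real.log n / n) ≤ 1 := by
        rw [Real.sqrt_le_left zero_le_one, one_pow, div_le_one hn0]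
        linarith [Real.log_le_sub_one_of_pos hn0]
      linarith
    have hβn : δ ^ 2 * β n * n ≤ Real.log n / 512 := by
      rw [Real.norm_of_nonneg hβ0, Real.norm_of_nonneg (by positivity)] at hb2
      rw [← mul_div_assoc, le_div_iff₀ (by positivity)] at hb2
      linarith
    have hc : 2 * Real.sqrt (2 * n) ≤
        Real.exp (-(8 * δ ^ 2 * (32 + 8 * β n * n))) * (n / 2 : ℕ) := by
      -- Here `y = n^(1/4)`. From `δ² ≤ 1/16`, `log n ≥ 128` and `δ²βn ≤ log n / 512`, the exponent
      -- is at most `log n / 8 + log n / 8`, so the tie sum is at least of order `y³`, against the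
      -- required `y²`.
      set y := Real.exp (Real.log n / 4) with hy
      have hy4 : y ^ 4 = n := by
        rw [hy, ← Real.exp_nat_mul, ← Real.exp_log hn0]
        congr 1
        rw [Real.exp_log hn0]; push_cast; ring
      have hy12 : 12 ≤ y := by linarith [Real.add_one_le_exp (Real.log n / 4)]
      have hsq : Real.sqrt (2 * n) ≤ 3 / 2 * y ^ 2 := by
        refine Real.sqrt_le_iff.2 ⟨by positivity, ?_⟩
        rw [← hy4]
        nlinarith [pow_pos (by linarith : 0 < y) 4]
      have hexp : y⁻¹ ≤ Real.exp (-(8 * δ ^ 2 * (32 + 8 * β n * n))) := by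
        rw [hy, ← Real.exp_neg]
        refine Real.exp_le_exp.2 ?_
        linarith
      have hM : (n : ℝ) / 4 ≤ (n / 2 : ℕ) := by
        have : n ≤ 4 * (n / 2) := by omega
        have : (n : ℝ) ≤ 4 * (n / 2 : ℕ) := by exact_mod_cast this
        linarith
      calc 2 * Real.sqrt (2 * n) ≤ 3 * y ^ 2 := by linarith
        _ ≤ y ^ 3 / 4 := by nlinarith [pow_pos (by linarith : 0 < y) 2]
        _ = y⁻¹ * (n / 4) := by rw [← hy4]; field_simp
        _ ≤ _ := mul_le_mul hexp hM (by positivity) (Real.exp_pos _).le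
    have h := le_measureReal_exists_matchCost (hA n hn) (hX n hn) (hAX n hn) (hp n hn).le hn2
      hδ16 hc
    refine (ENNReal.ofReal_le_ofReal h).trans ?_
    rw [ofReal_measureReal]
    refine measure_mono ?_
    rintro ω ⟨s, hs, hle⟩
    have hone := one_le_mleError (hP n hn) hs hle
    rw [← corrupt_eq, ← hB n hn] at hone
    rw [Set.mem_ofPred_eq, edist_dist, Real.dist_eq, sub_zero, ← ENNReal.ofReal_one]
    exact ENNReal.ofReal_le_ofReal (hone.trans (le_abs_self _))
  have := ge_of_tendsto hlim hlow
  simp at this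
  norm_num at this

theorem mleStronglyConsistent {Ω : Type*} [MeasurableSpace Ω] {μ : Measure Ω}
    [IsProbabilityMeasure μ] {n₀ : ℕ} {d : ℕ → ℕ} {β p : ℕ → I}
    (hp : ∀ n, n₀ ≤ n → (p n : ℝ) < 1 / 2)
    {P : (n : ℕ) → Matrix (Fin n) (Fin n) ℝ} (hP : ∀ n, n₀ ≤ n → P n ∈ permMatrices n)
    {A X B : (n : ℕ) → Ω → Matrix (Fin n) (Fin n) ℝ}
    (hA : ∀ n, n₀ ≤ n → IsNewmanWatts μ n (d n) (β n) (A n))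
    (hX : ∀ n, n₀ ≤ n → IsChannelNoise μ n (p n) (X n))
    (hAX : ∀ n, n₀ ≤ n → IndepFun (A n) (X n) μ)
    (hB : ∀ n, n₀ ≤ n → ∀ ω, B n ω = corrupt (A n ω) (X n ω) (P n))
    (h1 : (fun n : ℕ => (d n : ℝ)) =o[atTop] (fun n : ℕ => (β n : ℝ) ^ 2 * n))
    (hβ : ∀ n, n₀ ≤ n → (β n : ℝ) ≤ 1 / 2)
    (h2 : (fun n : ℕ => Real.sqrt (Real.log n / ((1 / 2 - (p n : ℝ)) ^ 2 * n))) =o[atTop]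
        (fun n : ℕ => (β n : ℝ))) :
    MLEStronglyConsistent μ A B P := by
  set S : ℕ → Set Ω := fun n => {ω | ∃ s : Equiv.Perm (Fin n), s ≠ 1 ∧
      matchCost (A n ω) (corrupt (A n ω) (X n ω) 1) s ≤
        matchCost (A n ω) (corrupt (A n ω) (X n ω) 1) 1} with hS
  have hev : ∀ᶠ n : ℕ in atTop, μ.real (S n) ≤ 2 / (n : ℝ) ^ 2 := by
    -- With `1/32` and `β² ≤ 1`, `16d ≤ n/2`, while `n ≥ 32` absorbs the remaining 16. With `1/10`
    -- and `β² ≤ β`, `δ²βn ≥ 100 log n`, which covers the required 96.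
    filter_upwards [eventually_ge_atTop n₀, eventually_ge_atTop 32,
      h1.bound (by norm_num : (0 : ℝ) < 1 / 32),
      h2.bound (by norm_num : (0 : ℝ) < 1 / 10)] with n hn hn2 hb1 hb2
    have hn0 : (0 : ℝ) < n := by positivity
    have hn32 : (32 : ℝ) ≤ n := by exact_mod_cast hn2
    have hβ0 := (β n).2.1
    have hβ1 := (β n).2.2
    have hδ0 : 0 < 1 / 2 - (p n : ℝ) := by linarith [hp n hn]
    refine measureReal_exists_matchCost_le (hA n hn) (hX n hn) (hAX n hn) (hβ n hn) (hp n hn).le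
      ?_ ?_
    · rw [Real.norm_of_nonneg (by positivity), Real.norm_of_nonneg (by positivity)] at hb1
      have hsq : (β n : ℝ) ^ 2 ≤ 1 := by nlinarith
      have : 16 * ((d n : ℝ) + 1) ≤ n := by nlinarith
      exact_mod_cast this
    · rw [Real.norm_of_nonneg (Real.sqrt_nonneg _), Real.norm_of_nonneg hβ0] at hb2
      have h := (Real.sqrt_le_left (by positivity)).1 hb2
      rw [div_le_iff₀ (by positivity)] at h
      have hsq : (β n : ℝ) ^ 2 ≤ β n := by nlinarith
      have hnn : 0 ≤ (1 / 2 - (p n : ℝ)) ^ 2 * n := by positivity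
      have := mul_le_mul_of_nonneg_right hsq hnn
      have := mul_nonneg hβ0 hnn
      linarith
  obtain ⟨N, hN⟩ := eventually_atTop.1 hev
  -- The bound holds only from `N` on, so Borel–Cantelli is applied to the shifted sequence.
  have hsum : ∑' k, μ (S (k + N)) ≠ ⊤ := by
    have hs : Summable fun k : ℕ => 2 / ((k + N : ℕ) : ℝ) ^ 2 := by
      have := (Real.summable_one_div_nat_pow (p := 2)).2 (by norm_num)
      have := (this.mul_left 2).comp_injective (add_left_injective N)
      refine this.congr fun k => ?_
      simp [div_eq_mul_inv]
    refine ne_top_of_le_ne_top hs.tsum_ofReal_ne_top (ENNReal.tsum_le_tsum fun k => ?_)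
    rw [← ofReal_measureReal]
    exact ENNReal.ofReal_le_ofReal (hN _ (by omega))
  filter_upwards [ae_eventually_notMem hsum] with ω hω
  have hω' : ∀ᶠ n in atTop, ω ∉ S n := by
    obtain ⟨K, hK⟩ := eventually_atTop.1 hω
    filter_upwards [eventually_ge_atTop (K + N)] with n hn
    have := hK (n - N) (by omega)
    rwa [Nat.sub_add_cancel (by omega)] at this
  refine Tendsto.congr' ?_ tendsto_const_nhds
  filter_upwards [hω', eventually_ge_atTop n₀] with n hn hn0
  rw [hB n hn0, corrupt_eq, mleError_eq_zero (hP n hn0)]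
  intro s hs
  by_contra hle
  exact hn ⟨s, hs, not_lt.1 hle⟩

theorem corollary3 {Ω : Type*} [MeasurableSpace Ω] (μ : Measure Ω) [IsProbabilityMeasure μ]
    (n₀ : ℕ) (hn₀ : 0 < n₀)
    (d : ℕ → ℕ) (β p : ℕ → I)
    (hp : ∀ n, n₀ ≤ n → (p n : ℝ) < 1 / 2)
    (P : (n : ℕ) → Matrix (Fin n) (Fin n) ℝ) (hP : ∀ n, n₀ ≤ n → P n ∈ permMatrices n)
    (A X B : (n : ℕ) → Ω → Matrix (Fin n) (Fin n) ℝ)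
    -- independent Newman-Watts graphs
    (hA : ∀ n, n₀ ≤ n → IsNewmanWatts μ n (d n) (β n) (A n))
    (hA_indep : iIndepFun (fun (n : Set.Ici n₀) => A n) μ)
    -- independent channel noise, independent of the graphs
    (hX : ∀ n, n₀ ≤ n → IsChannelNoise μ n (p n) (X n))
    (hX_indep : iIndepFun (fun (n : Set.Ici n₀) => X n) μ)
    (hAX_indep : ∀ n, n₀ ≤ n → IndepFun (A n) (X n) μ)
    -- the channel-corrupted graphs
    (hB : ∀ n, n₀ ≤ n → ∀ ω, B n ω = corrupt (A n ω) (X n ω) (P n)) :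
    -- part (a)
    ((fun n : ℕ => (1 / 2 - (p n : ℝ)) ^ 2) =o[atTop]
        (fun n : ℕ => Real.sqrt (Real.log n / n)) →
      (fun n : ℕ => (β n : ℝ)) =o[atTop]
        (fun n : ℕ => Real.log n / ((1 / 2 - (p n : ℝ)) ^ 2 * n)) →
      ¬ MLEWeaklyConsistent μ A B P) ∧
    -- part (b)
    ((fun n : ℕ => (d n : ℝ)) =o[atTop] (fun n : ℕ => (β n : ℝ) ^ 2 * n) →
      (∀ n, n₀ ≤ n → (β n : ℝ) ≤ 1 / 2) →
      (fun n : ℕ => Real.sqrt (Real.log n / ((1 / 2 - (p n : ℝ)) ^ 2 * n))) =o[atTop]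
        (fun n : ℕ => (β n : ℝ)) →
      MLEStronglyConsistent μ A B P) := by
  exact ⟨fun h1 h2 => not_mleWeaklyConsistent hp hP hA hX hAX_indep hB h1 h2,
    fun h1 hβ h2 => mleStronglyConsistent hp hP hA hX hAX_indep hB h1 hβ h2⟩
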